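/- Let $(W,S)$ be a finite Coxeter system, let $n=|S|$, and let $k$ be a field whose characteristic does not divide $|W|$. For $w\in W$ let $\ell(w)$ be the length of $w$ with respect to $S$. For $J\subseteq S$ let $W_J=\langle J\rangle$, let $X_J$ be the set of elements of $W$ that have minimal length in their coset $wW_J$, and let $x_J=\sum_{w\in X_J}w$ in the group algebra $kW$. The descent algebra $\mathcal D_k(W)$ is the subalgebra of $kW$ generated by the elements $x_J$, $J\subseteq S$ (by Solomon's theorem these elements form a $k$-basis of it). The Loewy length of a $k$-algebra $A$ is the smallest integer $\ell\ge 0$ such that $\operatorname{rad}^\ell(A)=0$, where $\operatorname{rad}(A)$ is the Jacobson radical of $A$. If $W$ is of one of the types $A_1$, $B_m$ $(m\ge 1)$, $D_{2m}$ $(m\ge 1)$, $E_7$, $E_8$, $F_4$, $I_2(2m)$ $(m\ge 1)$, $H_3$, $H_4$ (where $B_1=A_1$ and $D_2=I_2(2)=A_1\times A_1$), then the Loewy length of $\mathcal D_k(W)$ exists and is at most $\frac{n+1}{2}$. -/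

import Mathlib

noncomputable section

namespace DescentAlg

/-- The Coxeter matrix of type `Dₙ`, i.e. of the diagram with nodes `0, …, n - 1` in which
`0 — 1 — ⋯ — (n - 2)` is a path and the node `n - 1` is joined to the node `n - 3` only, all
edges being simple.  (For `n = 2` it has two nodes and no edge.)

The matrix `CoxeterMatrix.D` of Mathlib is not used, because it also joins the nodes `n - 2` and
`n - 1`, so that its diagram contains a triangle. -/
def matrixD (n : ℕ) : CoxeterMatrix (Fin n) where
  M := Matrix.of fun i j : Fin n ↦
    if i = j then 1
    else if ((i : ℕ) + 1 = j ∧ (j : ℕ) + 1 < n) ∨ ((j : ℕ) + 1 = i ∧ (i : ℕ) + 1 < n) ∨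
        ((i : ℕ) + 2 = j ∧ (j : ℕ) + 1 = n) ∨ ((j : ℕ) + 2 = i ∧ (i : ℕ) + 1 = n) then 3
    else 2
  isSymm := by
    ext i j
    simp only [Matrix.transpose_apply, Matrix.of_apply]
    have h : (j = i) ↔ (i = j) := eq_comm
    simp only [h]
    congr 2
    apply propext
    tauto
  diagonal := by simp
  off_diagonal := by
    intro i j h
    simp only [Matrix.of_apply, h, if_false]
    split_ifs <;> decide

/-- Two Coxeter matrices are of the same type if they agree up to a bijection of index sets. -/
def SameType {B B' : Type*} (M : CoxeterMatrix B) (N : CoxeterMatrix B') : Prop :=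
  ∃ e : B ≃ B', M.reindex e = N

/-- The Coxeter matrix `M` is of one of the types `A₁`, `Bₘ` (`m ≥ 1`), `D₂ₘ` (`m ≥ 1`), `E₇`,
`E₈`, `F₄`, `I₂(2m)` (`m ≥ 1`), `H₃`, `H₄`.  Mathlib's `CoxeterMatrix.I r` is the Coxeter matrix of
type `I₂(r + 2)`. -/
def IsListedType {B : Type*} (M : CoxeterMatrix B) : Prop :=
  SameType M (CoxeterMatrix.A 1) ∨
  (∃ m : ℕ, 1 ≤ m ∧ SameType M (CoxeterMatrix.B m)) ∨
  (∃ m : ℕ, 1 ≤ m ∧ SameType M (matrixD (2 * m))) ∨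
  SameType M CoxeterMatrix.E₇ ∨
  SameType M CoxeterMatrix.E₈ ∨
  SameType M CoxeterMatrix.F₄ ∨
  (∃ m r : ℕ, 1 ≤ m ∧ r + 2 = 2 * m ∧ SameType M (CoxeterMatrix.I r)) ∨
  SameType M CoxeterMatrix.H₃ ∨
  SameType M CoxeterMatrix.H₄

section Descent

variable {B W : Type*} [Group W] {M : CoxeterMatrix B} (cs : CoxeterSystem M W)

/-- The parabolic subgroup `W_J` generated by the simple reflections indexed by `J`. -/
def parabolic (J : Set B) : Subgroup W :=
  Subgroup.closure (cs.simple '' J)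

/-- The set `X_J` of the elements `w` that have minimal length in their coset `w W_J`. -/
def minCosetReps (J : Set B) : Set W :=
  {w | ∀ v ∈ parabolic cs J, cs.length w ≤ cs.length (w * v)}

/-- The element `x_J = ∑_{w ∈ X_J} w` of the group algebra `kW`. -/
def xElt (k : Type*) [Field k] [Finite W] (J : Set B) : MonoidAlgebra k W :=
  ∑ w ∈ (Set.toFinite (minCosetReps cs J)).toFinset, MonoidAlgebra.of k W w

/-- The descent algebra of `(W, S)` over `k`: the subalgebra of `kW` determined by the elements
`x_J`, `J ⊆ S`.  By Solomon's theorem these elements are a `k`-basis of a subalgebra of `kW`; that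
subalgebra is the one they generate. -/
def descentAlgebra (k : Type*) [Field k] [Finite W] : Subalgebra k (MonoidAlgebra k W) :=
  Algebra.adjoin k (Set.range (xElt cs k))

end Descent

/-- `l` is the Loewy length of the ring `A`: the smallest natural number `l` such that the `l`-th
power of the Jacobson radical of `A` is zero. -/
def IsLoewyLength (A : Type*) [Ring A] (l : ℕ) : Prop :=
  IsLeast {r : ℕ | Ring.jacobson A ^ r = ⊥} l

end DescentAlg

end

/-! Let `F_m` be the span of the `x_K` with `|K| < m`. The proof shows that the radical lowers this
filtration by two steps at a time, because the longest element `w₀` is central in all the listed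
types.

Solomon's theorem is needed only in the form that `x_J x_K` lies in the span of the `x_L` with `L ⊆
K` (`xElt_mul_xElt_mem`). Hence left multiplication by the descent algebra is triangular, and an
element of the radical acts as zero on each diagonal piece, so it maps `F_m` into `F_{m-1}`.

Multiplication by `w₀` complements descent sets, which gives `w₀ x_K = ∑_{L ⊆ K} (-1)^|L| x_L`
(`of_mul_xElt`). If `w₀` is central, right multiplication by `w₀` acts on `F_m / F_{m-1}` by the
sign `(-1)^(m-1)`. It commutes with left multiplication by `r`, and consecutive layers carry
opposite signs. As 2 is invertible, a radical element sends `F_m` into `F_{m-2}`. Since `1 = x_S`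
lies in `F_{n+1}`, the power `rad ^ ⌊(n+1)/2⌋` lies in `F_1 = k x_∅`. Since `x_∅² = |W| x_∅` with
`|W| ≠ 0` in `k`, no nonzero multiple of `x_∅` is in the radical.

Conjugation by `w₀` permutes the simple reflections, inducing a diagram automorphism `σ`; centrality
means `σ = id`. Some listed diagrams have no symmetry. For the others, sign characters of `W` rule
the symmetries out, or, in type `D` of even rank, an invariant of the action on sign vectors does.
-/

noncomputable section

/-! ### The geometric representation and the orders of products of two simple reflections. -/

namespace CoxeterMatrix

open Real Polynomial.Chebyshev

variable {B : Type*} (M : CoxeterMatrix B)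

/-- The linear form `y ↦ 2⟨e_i, y⟩` on the geometric representation of `M`. -/
def coroot (i : B) : Module.Dual ℝ (B →₀ ℝ) :=
  Finsupp.linearCombination ℝ fun j ↦ -2 * cos (π / M i j)

theorem coroot_single (i j : B) : M.coroot i (Finsupp.single j 1) = -2 * cos (π / M i j) := by
  simp [coroot]

theorem coroot_single_self (i : B) : M.coroot i (Finsupp.single i 1) = 2 := by
  simp [coroot_single]

/-- The simple reflections of the geometric representation of `M`. -/
def geomReflection (i : B) : (B →₀ ℝ) ≃ₗ[ℝ] (B →₀ ℝ) :=
  Module.reflection (M.coroot_single_self i)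

theorem coroot_mul_coroot (i j : B) :
    M.coroot i (Finsupp.single j 1) * M.coroot j (Finsupp.single i 1) - 2 =
      2 * cos (2 * (π / M i j)) := by
  rw [coroot_single, coroot_single, M.symmetric j i, cos_two_mul]
  ring

theorem three_le_of_ne {i j : B} (h : i ≠ j) (h0 : M i j ≠ 0) (h2 : M i j ≠ 2) : 3 ≤ M i j := by
  have := M.off_diagonal i j h
  have h1 : M i j ≠ 1 := this
  omega

theorem sin_two_mul_pi_div_pos {m : ℕ} (hm : 3 ≤ m) : 0 < sin (2 * (π / m)) := by
  have h3 : (3 : ℝ) ≤ m := by exact_mod_cast hm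
  have hp := pi_pos
  apply sin_pos_of_pos_of_lt_pi
  · positivity
  · rw [← mul_div_assoc, div_lt_iff₀ (by linarith)]
    nlinarith

/-- Powers of a product of two reflections are governed by Chebyshev polynomials with `S_n(2 cos φ)
sin φ = sin ((n + 1) φ)`, where `φ = 2π / m`. For `m = 2p` the factor `S_{p-1}` vanishes because `p
φ = π`; for `m = 2p + 1` the factor `S_p + S_{p-1}` vanishes because `(2p + 1) φ = 2π`. The case `m
= 2` is separate since then `sin φ = 0`; the entry `0` stands for infinite order. -/
theorem isLiftable_geomReflection : M.IsLiftable M.geomReflection := by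
  intro i j
  by_cases hij : i = j
  · subst hij
    rw [M.diagonal, pow_one]
    ext1 z
    exact Module.involutive_reflection (M.coroot_single_self i) z
  by_cases h0 : M i j = 0
  · rw [h0, pow_zero]
  by_cases h2 : M i j = 2
  · have e1 : M.coroot i (Finsupp.single j 1) = 0 := by
      rw [coroot_single, h2]; simp
    have e2 : M.coroot j (Finsupp.single i 1) = 0 := by
      rw [coroot_single, M.symmetric j i, h2]; simp
    rw [h2]
    apply LinearEquiv.ext
    intro z
    simp only [geomReflection, pow_two, LinearEquiv.mul_apply, Module.reflection_apply, map_sub,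
      map_smul, e1, e2, coroot_single_self, LinearEquiv.coe_one, id_eq]
    module
  · have h3 := M.three_le_of_ne hij h0 h2
    have hs := sin_two_mul_pi_div_pos h3
    have hm : (M i j : ℝ) ≠ 0 := by exact_mod_cast h0
    apply LinearEquiv.ext
    intro z
    rw [geomReflection, geomReflection,
      Module.reflection_mul_reflection_pow_apply _ _ _ _ _ (M.coroot_mul_coroot i j).symm]
    set φ := 2 * (π / M i j) with hφ
    have key (n : ℤ) : (S ℝ n).eval (2 * cos φ) = sin ((n + 1) * φ) / sin φ := by
      rw [eq_div_iff hs.ne', S_two_mul_real_cos]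
    obtain ⟨p, hp | hp⟩ := Nat.even_or_odd' (M i j)
    · have a1 : ((M i j : ℤ) - 2) / 2 = p - 1 := by omega
      have a2 : ((M i j : ℤ) - 1) / 2 = p - 1 := by omega
      have hz : (S ℝ ((p : ℤ) - 1)).eval (2 * cos φ) = 0 := by
        rw [key]
        have : (((p : ℤ) - 1 : ℤ) + 1 : ℝ) * φ = π := by
          have hpm : (M i j : ℝ) = 2 * p := by exact_mod_cast hp
          push_cast
          rw [hφ, hpm]
          rw [hpm] at hm
          have hp0 : (p : ℝ) ≠ 0 := right_ne_zero_of_mul hm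
          field_simp
          ring
        rw [this]; simp
      rw [a1, a2, hz]
      simp
    · have a1 : ((M i j : ℤ) - 2) / 2 = p - 1 := by omega
      have a2 : ((M i j : ℤ) - 1) / 2 = p := by omega
      have a3 : ((M i j : ℤ) - 3) / 2 = p - 1 := by omega
      have a4 : (M i j : ℤ) / 2 = p := by omega
      have hz : (S ℝ (p : ℤ)).eval (2 * cos φ) + (S ℝ ((p : ℤ) - 1)).eval (2 * cos φ) = 0 := by
        rw [key, key, ← add_div]
        have : sin ((((p : ℤ) : ℝ) + 1) * φ) = - sin (((((p : ℤ) - 1 : ℤ) : ℝ) + 1) * φ) := by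
          rw [← sin_two_pi_sub]
          congr 1
          have hpm : (M i j : ℝ) = 2 * p + 1 := by exact_mod_cast hp
          push_cast
          rw [hφ, hpm]
          rw [hpm] at hm
          field_simp
          ring
        rw [this]; simp
      rw [a1, a2, a3, a4, hz]
      simp

end CoxeterMatrix

namespace CoxeterSystem

open Real Polynomial.Chebyshev

variable {B W : Type*} [Group W] {M : CoxeterMatrix B} (cs : CoxeterSystem M W)

/-- The geometric representation. -/
def geomRep : W →* ((B →₀ ℝ) ≃ₗ[ℝ] (B →₀ ℝ)) :=
  cs.lift ⟨M.geomReflection, M.isLiftable_geomReflection⟩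

theorem geomRep_simple (i : B) : cs.geomRep (cs.simple i) = M.geomReflection i :=
  cs.lift_apply_simple _ i

/-- Apply the `k`-th power to `e_i`: the `e_j`-coordinate gives `sin (k φ) = 0`, and then the
`e_i`-coordinate gives `cos (k φ) = 1`, so `k φ` is a multiple of `2π`. -/
theorem dvd_of_simple_mul_simple_pow_eq_one {i j : B} (h0 : M i j ≠ 0) {k : ℕ}
    (h : (cs.simple i * cs.simple j) ^ k = 1) : M i j ∣ k := by
  by_cases hij : i = j
  · subst hij
    rw [M.diagonal]
    exact one_dvd k
  have hne : (Finsupp.single i (1 : ℝ)) ≠ 0 := by simp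
  have hrep : (M.geomReflection i * M.geomReflection j) ^ k = 1 := by
    rw [← cs.geomRep_simple, ← cs.geomRep_simple, ← map_mul, ← map_pow, h, map_one]
  by_cases h2 : M i j = 2
  · rw [h2]
    rw [← even_iff_two_dvd]
    by_contra hodd
    rw [Nat.not_even_iff_odd] at hodd
    have e2 : M.coroot j (Finsupp.single i 1) = 0 := by
      rw [CoxeterMatrix.coroot_single, M.symmetric j i, h2]; simp
    have step : (M.geomReflection i * M.geomReflection j) (Finsupp.single i 1) =
        - Finsupp.single i 1 := by
      simp only [CoxeterMatrix.geomReflection, LinearEquiv.mul_apply]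
      rw [Module.reflection_apply _ (M.coroot_single_self j), e2, zero_smul, sub_zero,
        Module.reflection_apply_self]
    have hpow (n : ℕ) : ((M.geomReflection i * M.geomReflection j) ^ n) (Finsupp.single i 1) =
        (-1 : ℝ) ^ n • Finsupp.single i 1 := by
      induction n with
      | zero => simp
      | succ n ih =>
        rw [pow_succ, LinearEquiv.mul_apply, step, map_neg, ih, pow_succ, mul_neg_one, neg_smul]
    have := hpow k
    rw [hrep, hodd.neg_one_pow] at this
    have := congrArg (fun v : B →₀ ℝ ↦ v i) this
    simp at this
    linarith
  · have h3 := M.three_le_of_ne hij h0 h2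
    have hs := CoxeterMatrix.sin_two_mul_pi_div_pos h3
    have hm : (M i j : ℝ) ≠ 0 := by exact_mod_cast h0
    have := Module.reflection_mul_reflection_pow_apply_self (M.coroot_single_self i)
      (M.coroot_single_self j) k _ (M.coroot_mul_coroot i j).symm
    change ((M.geomReflection i * M.geomReflection j) ^ k) _ = _ at this
    rw [hrep] at this
    set φ := 2 * (π / M i j) with hφ
    have key (n : ℤ) : (S ℝ n).eval (2 * cos φ) = sin ((n + 1) * φ) / sin φ := by
      rw [eq_div_iff hs.ne', S_two_mul_real_cos]
    have hcj : M.coroot j (Finsupp.single i 1) ≠ 0 := by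
      rw [CoxeterMatrix.coroot_single, M.symmetric j i]
      have : 0 < cos (π / M i j) := by
        apply cos_pos_of_mem_Ioo
        have h3' : (3 : ℝ) ≤ M i j := by exact_mod_cast h3
        have hp := pi_pos
        constructor
        · have : 0 < π / M i j := by positivity
          linarith
        · rw [div_lt_iff₀ (by linarith)]
          nlinarith
      linarith
    have c1 := congrArg (fun v : B →₀ ℝ ↦ v j) this
    have c2 := congrArg (fun v : B →₀ ℝ ↦ v i) this
    simp [hij, Ne.symm hij, hcj] at c1 c2
    rw [c1, add_zero, key] at c2
    rw [key] at c1
    have hsin : sin (k * φ) = 0 := by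
      have := (div_eq_zero_iff.1 c1).resolve_right hs.ne'
      simpa using this
    have hcos : cos (k * φ) = 1 := by
      rw [eq_div_iff hs.ne', one_mul] at c2
      push_cast at c2
      rw [add_mul, one_mul, sin_add, hsin, zero_mul, zero_add] at c2
      exact (mul_right_cancel₀ hs.ne' (by rw [one_mul]; exact c2)).symm
    obtain ⟨n, hn⟩ := (cos_eq_one_iff _).1 hcos
    have hn' : (n : ℝ) * M i j = k := by
      have hp := pi_ne_zero
      rw [hφ] at hn
      field_simp at hn
      linarith
    have : (M i j : ℤ) ∣ k := ⟨n, by rw [mul_comm]; exact_mod_cast hn'.symm⟩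
    exact_mod_cast this

theorem orderOf_simple_mul_simple {i j : B} (h0 : M i j ≠ 0) :
    orderOf (cs.simple i * cs.simple j) = M i j :=
  Nat.dvd_antisymm (orderOf_dvd_of_pow_eq_one (cs.simple_mul_simple_pow i j))
    (cs.dvd_of_simple_mul_simple_pow_eq_one h0 (pow_orderOf_eq_one _))

/-- The reflection `s_i` negates `e_i`, whereas `s_j` leaves its `e_i`-coordinate unchanged. This
identifies `|S|` with the cardinality of `B`. -/
theorem simple_injective : Function.Injective cs.simple := by
  intro i j h
  by_contra hij
  have h1 : M.geomReflection i = M.geomReflection j := by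
    rw [← cs.geomRep_simple, ← cs.geomRep_simple, h]
  have h2 := congrArg (fun v : B →₀ ℝ ↦ v i)
    (LinearEquiv.congr_fun h1 (Finsupp.single i 1))
  simp only [CoxeterMatrix.geomReflection] at h2
  rw [Module.reflection_apply_self, Module.reflection_apply] at h2
  simp [Ne.symm hij] at h2
  linarith

end CoxeterSystem

end

/-! ### Inversions as a sign cocycle, and the exchange condition. -/

noncomputable section

namespace CoxeterSystem

open Classical in
/-- The sign `-1` if `a = b`, and `1` otherwise. -/
def eqSign {α : Type*} (a b : α) : ℤˣ := if a = b then -1 else 1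

theorem eqSign_self {α : Type*} (a : α) : eqSign a a = -1 := by simp [eqSign]

theorem eqSign_of_ne {α : Type*} {a b : α} (h : a ≠ b) : eqSign a b = 1 := by simp [eqSign, h]

theorem eq_of_eqSign {α : Type*} {a b : α} (h : eqSign a b = -1) : a = b := by
  by_contra hab
  rw [eqSign_of_ne hab] at h
  exact absurd h (by decide)

theorem eqSign_congr {α : Type*} {a b c d : α} (h : a = b ↔ c = d) : eqSign a b = eqSign c d := by
  unfold eqSign
  split_ifs <;> tauto

variable {B W : Type*} [Group W] {M : CoxeterMatrix B} (cs : CoxeterSystem M W)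

theorem eqSign_simple_conj (i : B) (t : W) :
    eqSign (cs.simple i * t * cs.simple i) (cs.simple i) = eqSign t (cs.simple i) := by
  apply eqSign_congr
  rw [mul_eq_right, mul_eq_one_iff_inv_eq, cs.inv_simple, eq_comm]

/-- The action of a simple reflection on pairs of a group element and a sign, by conjugation of the
former; the sign changes if the group element is this simple reflection. -/
def signedConj (i : B) : Equiv.Perm (W × ℤˣ) where
  toFun p := (cs.simple i * p.1 * cs.simple i, eqSign p.1 (cs.simple i) * p.2)
  invFun p := (cs.simple i * p.1 * cs.simple i, eqSign p.1 (cs.simple i) * p.2)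
  left_inv p := by
    ext <;> simp [eqSign_simple_conj, ← mul_assoc, Int.units_mul_self]
  right_inv p := by
    ext <;> simp [eqSign_simple_conj, ← mul_assoc, Int.units_mul_self]

theorem signedConj_apply (i : B) (t : W) (e : ℤˣ) :
    cs.signedConj i (t, e) =
      (cs.simple i * t * cs.simple i, eqSign t (cs.simple i) * e) := rfl

theorem signedConj_mul_pow_apply (i j : B) (k : ℕ) (t : W) (e : ℤˣ) :
    ((cs.signedConj i * cs.signedConj j) ^ k) (t, e) =
      ((cs.simple i * cs.simple j) ^ k * t * ((cs.simple i * cs.simple j) ^ k)⁻¹,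
        (∏ n ∈ Finset.range (2 * k),
          eqSign t (cs.simple j * (cs.simple i * cs.simple j) ^ n)) * e) := by
  induction k with
  | zero => simp
  | succ k ih =>
    rw [pow_succ', Equiv.Perm.mul_apply, ih, Equiv.Perm.mul_apply, signedConj_apply,
      signedConj_apply]
    set c := cs.simple i * cs.simple j with hc
    have hcj : cs.simple j * c = c⁻¹ * cs.simple j := by
      simp [hc, mul_assoc]
    have hck (n : ℕ) : cs.simple j * c ^ n = (c ^ n)⁻¹ * cs.simple j := by
      induction n with
      | zero => simp
      | succ n ih =>
        rw [pow_succ, ← mul_assoc, ih, mul_assoc, hcj, ← mul_assoc, ← mul_inv_rev, ← pow_succ',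
          ← pow_succ]
    have e1 : eqSign (c ^ k * t * (c ^ k)⁻¹) (cs.simple j) =
        eqSign t (cs.simple j * c ^ (2 * k)) := by
      apply eqSign_congr
      rw [two_mul, pow_add, ← mul_assoc, hck, mul_inv_eq_iff_eq_mul, ← eq_inv_mul_iff_mul_eq,
        mul_assoc]
    have e2 : eqSign (cs.simple j * (c ^ k * t * (c ^ k)⁻¹) * cs.simple j) (cs.simple i) =
        eqSign t (cs.simple j * c ^ (2 * k + 1)) := by
      apply eqSign_congr
      have h : cs.simple j * c ^ (2 * k + 1) =
          (c ^ k)⁻¹ * cs.simple j * cs.simple i * cs.simple j * c ^ k := by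
        rw [show 2 * k + 1 = k + (1 + k) by ring, pow_add, ← mul_assoc, hck, pow_add, hc]
        simp [mul_assoc]
      rw [h]
      constructor
      · intro h'
        rw [← h']
        simp [mul_assoc]
      · rintro rfl
        simp [mul_assoc]
    have e3 : cs.simple i * (cs.simple j * (c ^ k * t * (c ^ k)⁻¹) * cs.simple j) * cs.simple i =
        c ^ (k + 1) * t * (c ^ (k + 1))⁻¹ := by
      rw [pow_succ', hc]
      simp [mul_assoc]
    rw [e1, e2, e3, show 2 * (k + 1) = 2 * k + 1 + 1 by ring, Finset.prod_range_succ,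
      Finset.prod_range_succ]
    congr 1
    rw [← mul_assoc, ← mul_assoc]
    congr 1
    rw [mul_comm, mul_comm (eqSign t _) (eqSign t _), mul_assoc, mul_comm (eqSign t _) (eqSign t _)]

/-- With `m = M i j`, the reflections `s_j (s_i s_j)^n` for `n < 2m` repeat with period `m`, so each
sign occurs twice and cancels. -/
theorem isLiftable_signedConj : M.IsLiftable cs.signedConj := by
  intro i j
  ext1 ⟨t, e⟩
  rw [signedConj_mul_pow_apply, cs.simple_mul_simple_pow, two_mul, Finset.prod_range_add]
  simp [pow_add, cs.simple_mul_simple_pow, Int.units_mul_self]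

/-- The action of `W` on pairs of a group element and a sign. -/
def signedConjHom : W →* Equiv.Perm (W × ℤˣ) :=
  cs.lift ⟨cs.signedConj, cs.isLiftable_signedConj⟩

theorem signedConjHom_simple (i : B) : cs.signedConjHom (cs.simple i) = cs.signedConj i :=
  cs.lift_apply_simple _ i

/-- The sign that is `-1` exactly at the right inversions of `w`. -/
def invSign (w t : W) : ℤˣ := (cs.signedConjHom w (t, 1)).2

theorem signedConjHom_apply (w t : W) (e : ℤˣ) :
    cs.signedConjHom w (t, e) = (w * t * w⁻¹, cs.invSign w t * e) := by
  suffices ∀ w : W, ∀ t : W, ∃ c : ℤˣ, ∀ e, cs.signedConjHom w (t, e) = (w * t * w⁻¹, c * e) by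
    obtain ⟨c, hc⟩ := this w t
    rw [invSign, hc, hc, mul_one]
  intro w
  induction w using cs.simple_induction_left with
  | one => exact fun t ↦ ⟨1, by simp⟩
  | mul_simple_left w i ih =>
    intro t
    obtain ⟨c, hc⟩ := ih t
    refine ⟨eqSign (w * t * w⁻¹) (cs.simple i) * c, fun e ↦ ?_⟩
    rw [map_mul, Equiv.Perm.mul_apply, hc, signedConjHom_simple, signedConj_apply]
    simp [mul_assoc]

theorem invSign_mul (u v t : W) :
    cs.invSign (u * v) t = cs.invSign u (v * t * v⁻¹) * cs.invSign v t := by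
  rw [invSign, map_mul, Equiv.Perm.mul_apply, signedConjHom_apply, signedConjHom_apply, mul_one]

theorem invSign_one (t : W) : cs.invSign 1 t = 1 := by simp [invSign]

theorem invSign_simple (i : B) (t : W) : cs.invSign (cs.simple i) t = eqSign t (cs.simple i) := by
  rw [invSign, signedConjHom_simple, signedConj_apply, mul_one]

theorem invSign_inv (u t : W) : cs.invSign u⁻¹ t = cs.invSign u (u⁻¹ * t * u) := by
  have := cs.invSign_mul u u⁻¹ t
  rw [mul_inv_cancel, invSign_one, inv_inv] at this
  rw [← mul_left_cancel_iff (a := cs.invSign u (u⁻¹ * t * u)), ← this, Int.units_mul_self]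

theorem invSign_self {t : W} (ht : cs.IsReflection t) : cs.invSign t t = -1 := by
  obtain ⟨u, i, rfl⟩ := ht
  rw [invSign_mul, invSign_mul, invSign_inv, invSign_simple]
  simp [mul_assoc, eqSign_self, Int.units_mul_self]

theorem mem_rightInvSeq_of_invSign {ω : List B} {t : W}
    (h : cs.invSign (cs.wordProd ω) t = -1) : t ∈ cs.rightInvSeq ω := by
  induction ω with
  | nil =>
    rw [cs.wordProd_nil, invSign_one] at h
    exact absurd h (by decide)
  | cons i ω ih =>
    rw [cs.wordProd_cons, invSign_mul, invSign_simple] at h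
    rw [rightInvSeq, List.mem_cons]
    rcases Int.units_eq_one_or (cs.invSign (cs.wordProd ω) t) with h' | h'
    · rw [h', mul_one] at h
      left
      rw [← eq_of_eqSign h]
      group
    · exact Or.inr (ih h')

/-- A sign `-1` places `t` in the inversion sequence of a reduced word, so `t` shortens `w`.
Conversely, the signs of `w` and `w t` at `t` are opposite; if `w` had sign `1`, the first direction
for `w t` would make `w` shorter than `w t`. -/
theorem invSign_eq_neg_one_iff {w t : W} (ht : cs.IsReflection t) :
    cs.invSign w t = -1 ↔ cs.length (w * t) < cs.length w := by
  have key : ∀ w : W, cs.invSign w t = -1 → cs.length (w * t) < cs.length w := by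
    intro w h
    obtain ⟨ω, hω, rfl⟩ := cs.exists_isReduced w
    exact (cs.isRightInversion_of_mem_rightInvSeq hω (cs.mem_rightInvSeq_of_invSign h)).2
  refine ⟨key w, fun h ↦ ?_⟩
  by_contra h'
  have h1 := (Int.units_eq_one_or _).resolve_right h'
  have h2 := key (w * t) (by
    rw [invSign_mul, cs.invSign_self ht, mul_inv_cancel_right, h1, one_mul])
  rw [mul_assoc, ht.mul_self, mul_one] at h2
  exact lt_asymm h h2

theorem invSign_eq_one_iff {w t : W} (ht : cs.IsReflection t) :
    cs.invSign w t = 1 ↔ cs.length w ≤ cs.length (w * t) := by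
  rw [← not_lt, ← cs.invSign_eq_neg_one_iff ht]
  rcases Int.units_eq_one_or (cs.invSign w t) with h | h <;> rw [h] <;> decide

theorem exists_eraseIdx_of_invSign {ω : List B} {t : W}
    (h : cs.invSign (cs.wordProd ω) t = -1) :
    ∃ j < ω.length, cs.wordProd ω * t = cs.wordProd (ω.eraseIdx j) := by
  obtain ⟨j, hj, rfl⟩ := List.mem_iff_getElem.1 (cs.mem_rightInvSeq_of_invSign h)
  refine ⟨j, by simpa using hj, ?_⟩
  rw [← cs.wordProd_mul_getD_rightInvSeq, List.getD_eq_getElem _ 1 hj]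

end CoxeterSystem

/-! ### Parabolic subgroups and minimal coset representatives. -/

namespace DescentAlg

variable {B W : Type*} [Group W] {M : CoxeterMatrix B} (cs : CoxeterSystem M W)

theorem simple_mem_parabolic {J : Set B} {i : B} (hi : i ∈ J) : cs.simple i ∈ parabolic cs J :=
  Subgroup.subset_closure ⟨i, hi, rfl⟩

/-- By the cocycle rule an inversion of a product is an inversion of the right factor or a
conjugate, by that factor, of an inversion of the left one. -/
theorem mem_parabolic_of_invSign {J : Set B} {u t : W} (hu : u ∈ parabolic cs J)
    (h : cs.invSign u t = -1) : t ∈ parabolic cs J := by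
  induction hu using Subgroup.closure_induction generalizing t with
  | mem x hx =>
    obtain ⟨i, hi, rfl⟩ := hx
    rw [cs.invSign_simple] at h
    rw [CoxeterSystem.eq_of_eqSign h]
    exact simple_mem_parabolic cs hi
  | one =>
    rw [cs.invSign_one] at h
    exact absurd h (by decide)
  | mul x y hx hy ihx ihy =>
    rw [cs.invSign_mul] at h
    rcases Int.units_eq_one_or (cs.invSign y t) with h' | h'
    · rw [h', mul_one] at h
      have := mul_mem (mul_mem (inv_mem hy) (ihx h)) hy
      simpa [mul_assoc, parabolic] using this
    · exact ihy h'
  | inv x hx ih =>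
    rw [cs.invSign_inv] at h
    have := mul_mem (mul_mem hx (ih h)) (inv_mem hx)
    simpa [mul_assoc, parabolic] using this

theorem invSign_eq_one_of_notMem_parabolic {J : Set B} {u t : W} (hu : u ∈ parabolic cs J)
    (h : t ∉ parabolic cs J) : cs.invSign u t = 1 :=
  (Int.units_eq_one_or _).resolve_right fun h' ↦ h (mem_parabolic_of_invSign cs hu h')

/-- Appending a letter of `J` either keeps the word reduced or, by the exchange condition, amounts
to deleting a letter; both keep the letters in `J`. -/
theorem exists_isReduced_of_mem_parabolic {J : Set B} {u : W} (hu : u ∈ parabolic cs J) :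
    ∃ ω : List B, (∀ i ∈ ω, i ∈ J) ∧ cs.IsReduced ω ∧ cs.wordProd ω = u := by
  have step : ∀ (ω : List B) (i : B), (∀ i ∈ ω, i ∈ J) → cs.IsReduced ω → i ∈ J →
      ∃ ω' : List B, (∀ i ∈ ω', i ∈ J) ∧ cs.IsReduced ω' ∧
        cs.wordProd ω' = cs.wordProd ω * cs.simple i := by
    intro ω i hω hr hi
    rcases cs.length_mul_simple (cs.wordProd ω) i with h | h
    · refine ⟨ω ++ [i], ?_, ?_, ?_⟩
      · simp only [List.mem_append, List.mem_singleton]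
        rintro j (hj | rfl)
        exacts [hω j hj, hi]
      · rw [CoxeterSystem.IsReduced, cs.wordProd_append, cs.wordProd_singleton, h, hr.eq]
        simp
      · rw [cs.wordProd_append, cs.wordProd_singleton]
    · obtain ⟨j, hj, hj'⟩ := cs.exists_eraseIdx_of_invSign
        ((cs.invSign_eq_neg_one_iff (cs.isReflection_simple i)).2 (by omega :
          cs.length (cs.wordProd ω * cs.simple i) < cs.length (cs.wordProd ω)))
      refine ⟨ω.eraseIdx j, fun l hl ↦ hω l (List.mem_of_mem_eraseIdx hl), ?_, hj'.symm⟩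
      rw [hj', hr.eq] at h
      have := List.length_eraseIdx_add_one hj
      rw [CoxeterSystem.IsReduced]
      omega
  induction hu using Subgroup.closure_induction_right with
  | one => exact ⟨[], by simp, by simp [CoxeterSystem.IsReduced], by simp⟩
  | mul_right x hx y hy ih =>
    obtain ⟨ω, h1, h2, rfl⟩ := ih
    obtain ⟨i, hi, rfl⟩ := hy
    exact step ω i h1 h2 hi
  | mul_inv_cancel x hx y hy ih =>
    obtain ⟨ω, h1, h2, rfl⟩ := ih
    obtain ⟨i, hi, rfl⟩ := hy
    rw [cs.inv_simple]
    exact step ω i h1 h2 hi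

theorem eq_one_of_mem_parabolic {J : Set B} {u : W} (hu : u ∈ parabolic cs J)
    (h : ∀ i ∈ J, cs.invSign u (cs.simple i) = 1) : u = 1 := by
  obtain ⟨ω, hω, hr, rfl⟩ := exists_isReduced_of_mem_parabolic cs hu
  rcases List.eq_nil_or_concat ω with rfl | ⟨ω', i, rfl⟩
  · simp
  · have := (cs.invSign_eq_one_iff (cs.isReflection_simple i)).1 (h i (hω i (by simp)))
    rw [hr.eq, cs.wordProd_concat, mul_assoc, cs.simple_mul_simple_self,
      mul_one] at this
    have := this.trans (cs.length_wordProd_le ω')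
    simp at this

theorem invSign_eq_one_of_mem_minCosetReps {J : Set B} {w t : W} (hw : w ∈ minCosetReps cs J)
    (ht : cs.IsReflection t) (htJ : t ∈ parabolic cs J) : cs.invSign w t = 1 :=
  (cs.invSign_eq_one_iff ht).2 (hw t htJ)

theorem isReflection_conj_simple (u : W) (i : B) : cs.IsReflection (u * cs.simple i * u⁻¹) :=
  (cs.isReflection_simple i).conj u

/-- No reflection of `W_J` is an inversion of `a`, so `a * u` and `u` have the same descents in `J`.
-/
theorem eq_one_of_mul_mem_minCosetReps {J : Set B} {a u : W} (ha : a ∈ minCosetReps cs J)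
    (hu : u ∈ parabolic cs J) (h : ∀ i ∈ J, cs.invSign (a * u) (cs.simple i) = 1) : u = 1 := by
  refine eq_one_of_mem_parabolic cs hu fun i hi ↦ ?_
  have := h i hi
  rwa [cs.invSign_mul, invSign_eq_one_of_mem_minCosetReps cs ha (isReflection_conj_simple cs u i)
    (mul_mem (mul_mem hu (simple_mem_parabolic cs hi)) (inv_mem hu)), one_mul] at this

theorem exists_mul_mem_minCosetReps (J : Set B) (w : W) :
    ∃ u ∈ parabolic cs J, w * u ∈ minCosetReps cs J := by
  obtain ⟨u, hu, hmin⟩ := exists_minimalFor_of_wellFoundedLT (fun u ↦ u ∈ parabolic cs J)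
    (fun u ↦ cs.length (w * u)) ⟨1, one_mem _⟩
  refine ⟨u, hu, fun v hv ↦ ?_⟩
  by_contra hlt
  rw [mul_assoc] at hlt
  exact hlt (hmin (mul_mem hu hv) (not_le.1 hlt).le)

/-- The elements of `X_J` are those without right descents in `J`. -/
theorem mem_minCosetReps_iff {J : Set B} {w : W} :
    w ∈ minCosetReps cs J ↔ ∀ i ∈ J, cs.invSign w (cs.simple i) = 1 := by
  refine ⟨fun h i hi ↦ invSign_eq_one_of_mem_minCosetReps cs h (cs.isReflection_simple i)
    (simple_mem_parabolic cs hi), fun h ↦ ?_⟩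
  obtain ⟨u, hu, hwu⟩ := exists_mul_mem_minCosetReps cs J w
  have := eq_one_of_mul_mem_minCosetReps cs hwu (inv_mem hu) (by simpa using h)
  rw [inv_eq_one] at this
  rwa [this, mul_one] at hwu

/-- Every coset of `W_J` contains a unique element of `X_J`. -/
theorem eq_of_mem_minCosetReps {J : Set B} {a b : W} (ha : a ∈ minCosetReps cs J)
    (hb : b ∈ minCosetReps cs J) (hab : a⁻¹ * b ∈ parabolic cs J) : a = b := by
  have := eq_one_of_mul_mem_minCosetReps cs ha hab
    (by simpa using (mem_minCosetReps_iff cs).1 hb)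
  rwa [inv_mul_eq_one] at this

end DescentAlg

end

/-! ### Solomon's theorem and the triangular action of the radical. -/

noncomputable section

namespace DescentAlg

variable {B W : Type*} [Group W] {M : CoxeterMatrix B} (cs : CoxeterSystem M W)

/-- The element of `X_J` in a coset of `W_J`. -/
def minRep (J : Set B) (q : W ⧸ parabolic cs J) : W :=
  q.out * (exists_mul_mem_minCosetReps cs J q.out).choose

theorem minRep_mem (J : Set B) (q : W ⧸ parabolic cs J) : minRep cs J q ∈ minCosetReps cs J :=
  (exists_mul_mem_minCosetReps cs J q.out).choose_spec.2

theorem mk_minRep (J : Set B) (q : W ⧸ parabolic cs J) :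
    (QuotientGroup.mk (minRep cs J q) : W ⧸ parabolic cs J) = q := by
  have := QuotientGroup.mk_mul_of_mem q.out
    (exists_mul_mem_minCosetReps cs J q.out).choose_spec.1
  rw [minRep, this, QuotientGroup.out_eq']

theorem minRep_mk {J : Set B} {a : W} (ha : a ∈ minCosetReps cs J) :
    minRep cs J (QuotientGroup.mk a : W ⧸ parabolic cs J) = a :=
  eq_of_mem_minCosetReps cs (minRep_mem cs J _) ha (QuotientGroup.eq.1 (mk_minRep cs J _))

/-- Write `a⁻¹ w = u g⁻¹` with `u ∈ W_J`, and let `i ∈ K`. If `g⁻¹ s_i g ∉ W_J`, then `u`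
contributes no sign and whether `s_i` is a descent depends on `g` alone; these conditions form `P`.
Otherwise `a` contributes no sign, so `s_i` is a descent of `a⁻¹ w` exactly when it is one of `w`;
these `i` form `L`. -/
theorem exists_inv_mul_mem_minCosetReps_iff (J K : Set B) (g : W) :
    ∃ L ⊆ K, ∃ P : Prop, ∀ w, ∀ a ∈ minCosetReps cs J, a⁻¹ * (w * g) ∈ parabolic cs J →
      (a⁻¹ * w ∈ minCosetReps cs K ↔ P ∧ w ∈ minCosetReps cs L) := by
  refine ⟨{i ∈ K | g⁻¹ * cs.simple i * g ∈ parabolic cs J}, fun i hi ↦ hi.1,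
    ∀ i ∈ K, g⁻¹ * cs.simple i * g ∉ parabolic cs J → cs.invSign g⁻¹ (cs.simple i) = 1,
    fun w a ha hag ↦ ?_⟩
  have h1 (i : B) (hi : g⁻¹ * cs.simple i * g ∉ parabolic cs J) :
      cs.invSign (a⁻¹ * w) (cs.simple i) = cs.invSign g⁻¹ (cs.simple i) := by
    rw [show a⁻¹ * w = a⁻¹ * (w * g) * g⁻¹ by group, cs.invSign_mul, inv_inv,
      invSign_eq_one_of_notMem_parabolic cs hag hi, one_mul]
  have h2 (i : B) (hi : g⁻¹ * cs.simple i * g ∈ parabolic cs J) :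
      cs.invSign (a⁻¹ * w) (cs.simple i) = cs.invSign w (cs.simple i) := by
    rw [cs.invSign_mul, cs.invSign_inv, invSign_eq_one_of_mem_minCosetReps cs ha, one_mul]
    · rw [show a⁻¹ * (w * cs.simple i * w⁻¹) * a = a⁻¹ * w * cs.simple i * (a⁻¹ * w)⁻¹ by group]
      exact isReflection_conj_simple cs _ _
    · have := mul_mem (mul_mem hag hi) (inv_mem hag)
      convert this using 1
      group
  simp only [mem_minCosetReps_iff, Set.mem_ofPred_eq, and_imp]
  constructor
  · intro h
    exact ⟨fun i hi hi' ↦ by rw [← h1 i hi', h i hi], fun i hi hi' ↦ by rw [← h2 i hi', h i hi]⟩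
  · rintro ⟨hP, hL⟩ i hi
    by_cases hi' : g⁻¹ * cs.simple i * g ∈ parabolic cs J
    · rw [h2 i hi', hL i hi hi']
    · rw [h1 i hi', hP i hi hi']

variable (k : Type*) [Field k] [Finite W]

theorem xElt_eq_sum [Fintype W] (J : Set B) [DecidablePred (· ∈ minCosetReps cs J)] :
    xElt cs k J = ∑ w : W, if w ∈ minCosetReps cs J then MonoidAlgebra.of k W w else 0 := by
  rw [xElt, ← Finset.sum_filter]
  congr 1
  ext w
  simp

/-- The span of the elements `x_L` with `L ⊆ K`. -/
def spanSubsets (K : Set B) : Submodule k (MonoidAlgebra k W) :=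
  Submodule.span k (xElt cs k '' {L | L ⊆ K})

/-- The span of the elements `x_L` with `L ⊂ K`. -/
def spanSSubsets (K : Set B) : Submodule k (MonoidAlgebra k W) :=
  Submodule.span k (xElt cs k '' {L | L ⊂ K})

/-- **Solomon's theorem**, in a qualitative form. -/
theorem xElt_mul_xElt_mem (J K : Set B) : xElt cs k J * xElt cs k K ∈ spanSubsets cs k K := by
  classical
  have := Fintype.ofFinite W
  have := Fintype.ofFinite (W ⧸ parabolic cs J)
  -- The coefficient of `w` counts the `a ∈ X_J` with `a⁻¹ w ∈ X_K`. Indexing `a` by the coset `q =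
  -- w⁻¹ a W_J` makes the summation set independent of `w`; each `q` then contributes zero or a
  -- single `x_L`.
  have key : xElt cs k J * xElt cs k K = ∑ q : W ⧸ parabolic cs J, ∑ w : W,
      if (minRep cs J (w • q))⁻¹ * w ∈ minCosetReps cs K then MonoidAlgebra.of k W w else 0 := by
    rw [Finset.sum_comm, xElt, xElt_eq_sum, Finset.sum_mul]
    have (a : W) : (MonoidAlgebra.of k W a *
        ∑ w : W, if w ∈ minCosetReps cs K then MonoidAlgebra.of k W w else 0) =
        ∑ w : W, if a⁻¹ * w ∈ minCosetReps cs K then MonoidAlgebra.of k W w else 0 := by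
      rw [← Equiv.sum_comp (Equiv.mulLeft a) fun w ↦
        if a⁻¹ * w ∈ minCosetReps cs K then MonoidAlgebra.of k W w else 0, Finset.mul_sum]
      refine Finset.sum_congr rfl fun w _ ↦ ?_
      simp only [Equiv.coe_mulLeft, inv_mul_cancel_left, map_mul, mul_ite, mul_zero]
    simp only [this]
    rw [Finset.sum_comm]
    refine Finset.sum_congr rfl fun w _ ↦ ?_
    refine Finset.sum_nbij' (fun a ↦ w⁻¹ • (a : W ⧸ parabolic cs J))
      (fun q ↦ minRep cs J (w • q)) ?_ ?_ ?_ ?_ ?_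
    · simp
    · intro q _
      simpa using minRep_mem cs J _
    · intro a ha
      rw [smul_inv_smul, minRep_mk cs (by simpa using ha)]
    · intro q _
      rw [mk_minRep, inv_smul_smul]
    · intro a ha
      rw [smul_inv_smul, minRep_mk cs (by simpa using ha)]
  rw [key]
  refine Submodule.sum_mem _ fun q _ ↦ ?_
  obtain ⟨g, rfl⟩ := QuotientGroup.mk_surjective q
  obtain ⟨L, hL, P, h⟩ := exists_inv_mul_mem_minCosetReps_iff cs J K g
  have h' (w : W) : (minRep cs J (w • (g : W ⧸ parabolic cs J)))⁻¹ * w ∈ minCosetReps cs K ↔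
      P ∧ w ∈ minCosetReps cs L :=
    h w _ (minRep_mem cs J _) (QuotientGroup.eq.1 (mk_minRep cs J _))
  simp only [h']
  by_cases hP : P
  · simp only [hP, true_and]
    rw [← xElt_eq_sum]
    exact Submodule.subset_span ⟨L, hL, rfl⟩
  · simp [hP]

variable {k}

theorem spanSubsets_mono {K L : Set B} (h : K ⊆ L) : spanSubsets cs k K ≤ spanSubsets cs k L :=
  Submodule.span_mono (Set.image_mono fun _ h' ↦ Set.Subset.trans h' h)

theorem spanSubsets_le_spanSSubsets {K L : Set B} (h : K ⊂ L) :
    spanSubsets cs k K ≤ spanSSubsets cs k L :=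
  Submodule.span_mono (Set.image_mono fun _ h' ↦ lt_of_le_of_lt h' h)

theorem mem_spanSubsets_iff {K : Set B} {x : MonoidAlgebra k W} :
    x ∈ spanSubsets cs k K ↔ ∃ c : k, ∃ y ∈ spanSSubsets cs k K, x = c • xElt cs k K + y := by
  have : {L | L ⊆ K} = insert K {L | L ⊂ K} := by
    ext L
    simp [le_iff_eq_or_lt]
  rw [spanSubsets, this, Set.image_insert_eq, Submodule.mem_span_insert]
  rfl

theorem mul_xElt_mem_spanSubsets {r : MonoidAlgebra k W} (hr : r ∈ descentAlgebra cs k)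
    (K : Set B) : r * xElt cs k K ∈ spanSubsets cs k K := by
  induction hr using Algebra.adjoin_induction generalizing K with
  | mem x hx =>
    obtain ⟨J, rfl⟩ := hx
    exact xElt_mul_xElt_mem cs k J K
  | algebraMap c =>
    rw [← Algebra.smul_def]
    exact Submodule.smul_mem _ _ (Submodule.subset_span ⟨K, Set.Subset.refl K, rfl⟩)
  | add x y _ _ hx hy =>
    rw [add_mul]
    exact add_mem (hx K) (hy K)
  | mul x y _ _ hx hy =>
    rw [mul_assoc]
    have hle : spanSubsets cs k K ≤
        (spanSubsets cs k K).comap (LinearMap.mulLeft k x) := by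
      refine Submodule.span_le.2 ?_
      rintro _ ⟨L, hL, rfl⟩
      exact spanSubsets_mono cs hL (hx L)
    exact hle (hy K)

theorem mul_mem_spanSSubsets {r : MonoidAlgebra k W} (hr : r ∈ descentAlgebra cs k)
    {K : Set B} {y : MonoidAlgebra k W} (hy : y ∈ spanSSubsets cs k K) :
    r * y ∈ spanSSubsets cs k K := by
  have hle : spanSSubsets cs k K ≤ (spanSSubsets cs k K).comap (LinearMap.mulLeft k r) := by
    refine Submodule.span_le.2 ?_
    rintro _ ⟨L, hL, rfl⟩
    exact spanSubsets_le_spanSSubsets cs hL (mul_xElt_mem_spanSubsets cs hr L)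
  exact hle hy

theorem exists_mul_one_sub_eq_one {A : Type*} [Ring A] {r : A} (hr : r ∈ Ring.jacobson A) :
    ∃ z : A, z * (1 - r) = 1 := by
  rw [← Ideal.jacobson_bot, Ideal.mem_jacobson_iff] at hr
  obtain ⟨z, hz⟩ := hr (-1)
  refine ⟨z, ?_⟩
  rw [Ideal.mem_bot, sub_eq_zero] at hz
  calc z * (1 - r) = z * -1 * r + z := by noncomm_ring
    _ = 1 := hz

/-- The radical acts as zero on the one-dimensional subquotients `⟨x_L : L ⊆ K⟩ / ⟨x_L : L ⊂ K⟩`. -/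
theorem jacobson_mul_xElt_mem {r : descentAlgebra cs k}
    (hr : r ∈ Ring.jacobson (descentAlgebra cs k)) (K : Set B) :
    (r : MonoidAlgebra k W) * xElt cs k K ∈ spanSSubsets cs k K := by
  obtain ⟨c, y, hy, h⟩ := (mem_spanSubsets_iff cs).1 (mul_xElt_mem_spanSubsets cs r.2 K)
  suffices c • xElt cs k K ∈ spanSSubsets cs k K by
    rw [h]
    exact add_mem this hy
  by_cases hc : c = 0
  · rw [hc, zero_smul]
    exact zero_mem _
  -- If `c ≠ 0`, then `1 - c⁻¹ r` maps `x_K` into the smaller span. Its left inverse preserves that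
  -- span, so `x_K` already lies there. Linear independence of the `x_L` plays no role.
  have hr' : c⁻¹ • r ∈ Ring.jacobson (descentAlgebra cs k) :=
    Submodule.smul_of_tower_mem _ _ hr
  obtain ⟨z, hz⟩ := exists_mul_one_sub_eq_one hr'
  have h1 : ((1 - c⁻¹ • r : descentAlgebra cs k) : MonoidAlgebra k W) * xElt cs k K =
      - (c⁻¹ • y) := by
    push_cast
    rw [sub_mul, one_mul, smul_mul_assoc, h, smul_add, inv_smul_smul₀ hc]
    abel
  have h2 : xElt cs k K = (z : MonoidAlgebra k W) * - (c⁻¹ • y) := by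
    rw [← h1, ← mul_assoc, ← Subalgebra.coe_mul, hz, Subalgebra.coe_one, one_mul]
  refine Submodule.smul_mem _ _ ?_
  rw [h2]
  exact mul_mem_spanSSubsets cs z.2 (neg_mem (Submodule.smul_mem _ _ hy))

end DescentAlg

end

/-! ### The longest element. -/

noncomputable section

namespace CoxeterSystem

variable {B W : Type*} [Group W] {M : CoxeterMatrix B} (cs : CoxeterSystem M W)

/-- `w₀` is the longest element: every reflection is an inversion. -/
def IsLongest (w₀ : W) : Prop := ∀ t, cs.IsReflection t → cs.invSign w₀ t = -1

theorem exists_isLongest [Finite W] : ∃ w₀, cs.IsLongest w₀ := by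
  obtain ⟨w₀, h⟩ := Finite.exists_max cs.length
  exact ⟨w₀, fun t ht ↦ (cs.invSign_eq_neg_one_iff ht).2
    (lt_of_le_of_ne (h _) (ht.length_mul_left_ne _))⟩

theorem eq_one_of_invSign {w : W} (h : ∀ i, cs.invSign w (cs.simple i) = 1) : w = 1 := by
  by_contra hw
  obtain ⟨i, hi⟩ := cs.exists_rightDescent_of_ne_one hw
  have := (cs.invSign_eq_neg_one_iff (cs.isReflection_simple i)).2 hi
  rw [h i] at this
  exact absurd this (by decide)

namespace IsLongest

variable {cs} {w₀ : W} (h : cs.IsLongest w₀)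
include h

theorem invSign_mul (w : W) {t : W} (ht : cs.IsReflection t) :
    cs.invSign (w₀ * w) t = - cs.invSign w t := by
  rw [cs.invSign_mul, h _ (ht.conj w), neg_one_mul]

theorem mul_self : w₀ * w₀ = 1 :=
  cs.eq_one_of_invSign fun i ↦ by
    rw [h.invSign_mul _ (cs.isReflection_simple i), h _ (cs.isReflection_simple i), neg_neg]

theorem inv_eq : w₀⁻¹ = w₀ := inv_eq_of_mul_eq_one_left h.mul_self

/-- Take a right descent `s_j` of `w₀ s_i w₀`. The two signs from `w₀` cancel in the cocycle,
leaving the sign of `s_i` at `w₀ s_j w₀`, which is `-1` only if these agree. -/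
theorem exists_conj_simple (i : B) : ∃ j, w₀ * cs.simple i * w₀ = cs.simple j := by
  have hne : w₀ * cs.simple i * w₀ ≠ 1 := by
    intro h1
    have := cs.length_simple i
    have h2 : cs.simple i = 1 := by
      have h3 : w₀ * (w₀ * cs.simple i * w₀) * w₀ = w₀ * w₀ := by rw [h1, mul_one]
      simpa only [mul_assoc, h.mul_self, mul_one, ← mul_assoc w₀ w₀, one_mul] using h3
    rw [h2, cs.length_one] at this
    exact absurd this (by decide)
  obtain ⟨j, hj⟩ := cs.exists_rightDescent_of_ne_one hne
  refine ⟨j, ?_⟩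
  have hs := cs.isReflection_simple j
  have := (cs.invSign_eq_neg_one_iff hs).2 hj
  have hr := hs.conj w₀
  rw [mul_assoc, h.invSign_mul _ hs, cs.invSign_mul, h _ hs, mul_neg_one, neg_neg,
    cs.invSign_simple, h.inv_eq] at this
  rw [← eq_of_eqSign this]
  simp only [mul_assoc, h.mul_self, mul_one, ← mul_assoc w₀ w₀, one_mul]

end IsLongest

end CoxeterSystem

/-! ### The filtration by cardinality and the bound for central `w₀`. -/

namespace DescentAlg

open CoxeterSystem

variable {B W : Type*} [Group W] {M : CoxeterMatrix B} (cs : CoxeterSystem M W)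
variable {k : Type*} [Field k]

theorem prod_ite_eq_one (w : W) (K : Finset B)
    [DecidablePred (· ∈ minCosetReps cs (K : Set B))] :
    (∏ i ∈ K, if cs.invSign w (cs.simple i) = 1 then (1 : k) else 0) =
      if w ∈ minCosetReps cs (K : Set B) then 1 else 0 := by
  rw [Finset.prod_ite_zero]
  simp [mem_minCosetReps_iff]

variable [Finite W]

/-- Multiplication of `x_K` by the longest element. -/
theorem of_mul_xElt {w₀ : W} (h : cs.IsLongest w₀) (K : Finset B) :
    MonoidAlgebra.of k W w₀ * xElt cs k K =
      ∑ L ∈ K.powerset, (-1 : k) ^ L.card • xElt cs k (L : Set B) := by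
  classical
  have := Fintype.ofFinite W
  -- The ascents of `w₀ w` are the descents of `w`, so the indicator is a product over `K` of
  -- factors `1 - [s_i is an ascent of w]`; expanding it gives the sum over subsets.
  have key (w : W) : (if w₀ * w ∈ minCosetReps cs (K : Set B) then (1 : k) else 0) =
      ∑ L ∈ K.powerset, (-1 : k) ^ L.card *
        (if w ∈ minCosetReps cs (L : Set B) then 1 else 0) := by
    have h1 (i : B) : (if cs.invSign (w₀ * w) (cs.simple i) = 1 then (1 : k) else 0) =
        -(if cs.invSign w (cs.simple i) = 1 then (1 : k) else 0) + 1 := by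
      rw [h.invSign_mul _ (cs.isReflection_simple i)]
      rcases Int.units_eq_one_or (cs.invSign w (cs.simple i)) with h' | h' <;> simp [h']
    rw [← prod_ite_eq_one cs]
    simp only [h1]
    rw [Finset.prod_add]
    refine Finset.sum_congr rfl fun L _ ↦ ?_
    rw [Finset.prod_neg, prod_ite_eq_one cs, Finset.prod_const_one, mul_one]
  have hx (L : Set B) : xElt cs k L =
      ∑ w : W, (if w ∈ minCosetReps cs L then (1 : k) else 0) • MonoidAlgebra.of k W w := by
    rw [xElt_eq_sum]
    simp only [ite_smul, one_smul, zero_smul]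
  have h2 : MonoidAlgebra.of k W w₀ * xElt cs k K =
      ∑ w : W, (if w₀ * w ∈ minCosetReps cs (K : Set B) then (1 : k) else 0) •
        MonoidAlgebra.of k W w := by
    rw [hx, Finset.mul_sum, ← Equiv.sum_comp (Equiv.mulLeft w₀) fun w ↦
      (if w₀ * w ∈ minCosetReps cs (K : Set B) then (1 : k) else 0) • MonoidAlgebra.of k W w]
    refine Finset.sum_congr rfl fun w _ ↦ ?_
    rw [Equiv.coe_mulLeft, ← mul_assoc, h.mul_self, one_mul, mul_smul_comm, map_mul]
  rw [h2]
  simp only [key, hx, Finset.sum_smul, Finset.smul_sum, smul_smul]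
  rw [Finset.sum_comm]

theorem of_mul_xElt_sub_mem {w₀ : W} (h : cs.IsLongest w₀) (K : Finset B) :
    MonoidAlgebra.of k W w₀ * xElt cs k K - (-1 : k) ^ K.card • xElt cs k (K : Set B) ∈
      spanSSubsets cs k (K : Set B) := by
  classical
  rw [of_mul_xElt cs h, ← Finset.sum_erase_add _ _ (Finset.mem_powerset_self K),
    add_sub_cancel_right]
  refine Submodule.sum_mem _ fun L hL ↦ Submodule.smul_mem _ _ (Submodule.subset_span ⟨L, ?_, rfl⟩)
  rw [Finset.mem_erase, Finset.mem_powerset] at hL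
  exact Finset.coe_ssubset.2 (lt_of_le_of_ne hL.2 hL.1)

variable (k) in
/-- The span of the elements `x_K` with `|K| < m`. -/
def spanCard (m : ℕ) : Submodule k (MonoidAlgebra k W) :=
  Submodule.span k ((fun K : Finset B ↦ xElt cs k (K : Set B)) '' {K | K.card < m})

theorem spanCard_mono {m n : ℕ} (h : m ≤ n) : spanCard cs k m ≤ spanCard cs k n :=
  Submodule.span_mono (Set.image_mono fun _ h' ↦ lt_of_lt_of_le h' h)

theorem xElt_mem_spanCard {K : Finset B} {m : ℕ} (h : K.card < m) :
    xElt cs k (K : Set B) ∈ spanCard cs k m :=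
  Submodule.subset_span ⟨K, h, rfl⟩

theorem spanSSubsets_le_spanCard (K : Finset B) :
    spanSSubsets cs k (K : Set B) ≤ spanCard cs k K.card := by
  refine Submodule.span_le.2 ?_
  rintro _ ⟨L, hL, rfl⟩
  have hfin : L.Finite := K.finite_toSet.subset hL.subset
  lift L to Finset B using hfin
  exact xElt_mem_spanCard cs (Finset.card_lt_card (Finset.coe_ssubset.1 hL))

theorem jacobson_mul_mem_spanCard_sub_one {r : descentAlgebra cs k}
    (hr : r ∈ Ring.jacobson (descentAlgebra cs k)) {m : ℕ} {y : MonoidAlgebra k W}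
    (hy : y ∈ spanCard cs k m) : (r : MonoidAlgebra k W) * y ∈ spanCard cs k (m - 1) := by
  have hle : spanCard cs k m ≤
      (spanCard cs k (m - 1)).comap (LinearMap.mulLeft k (r : MonoidAlgebra k W)) := by
    refine Submodule.span_le.2 ?_
    rintro _ ⟨K, hK : K.card < m, rfl⟩
    exact spanCard_mono cs (by omega) (spanSSubsets_le_spanCard cs K (jacobson_mul_xElt_mem cs hr K))
  exact hle hy

/-- The top layer of `F_m` consists of the `x_K` with `|K| = m - 1`, on which `w₀` acts by
`(-1)^(m-1)` modulo lower terms. Centrality turns right multiplication into left multiplication. -/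
theorem mul_of_add_mem_spanCard {w₀ : W} (h : cs.IsLongest w₀) (hc : ∀ w, w₀ * w = w * w₀)
    {m : ℕ} {y : MonoidAlgebra k W} (hy : y ∈ spanCard cs k m) :
    y * MonoidAlgebra.of k W w₀ + (-1 : k) ^ m • y ∈ spanCard cs k (m - 1) := by
  have hle : spanCard cs k m ≤ (spanCard cs k (m - 1)).comap
      (LinearMap.mulRight k (MonoidAlgebra.of k W w₀) + (-1 : k) ^ m • LinearMap.id) := by
    refine Submodule.span_le.2 ?_
    rintro _ ⟨K, hK : K.card < m, rfl⟩
    have hcomm : xElt cs k (K : Set B) * MonoidAlgebra.of k W w₀ =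
        MonoidAlgebra.of k W w₀ * xElt cs k (K : Set B) := by
      rw [xElt, Finset.sum_mul, Finset.mul_sum]
      exact Finset.sum_congr rfl fun w _ ↦ by rw [← map_mul, ← map_mul, hc]
    have h1 := spanSSubsets_le_spanCard cs K (of_mul_xElt_sub_mem (k := k) cs h K)
    change xElt cs k (K : Set B) * MonoidAlgebra.of k W w₀ +
      (-1 : k) ^ m • xElt cs k (K : Set B) ∈ spanCard cs k (m - 1)
    rw [hcomm, ← sub_add_cancel (MonoidAlgebra.of k W w₀ * xElt cs k (K : Set B))
      ((-1 : k) ^ K.card • xElt cs k (K : Set B)), add_assoc]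
    refine add_mem (spanCard_mono cs (by omega) h1) ?_
    by_cases hm : K.card = m - 1
    · obtain rfl : m = K.card + 1 := by omega
      rw [pow_succ, mul_neg_one, neg_smul, add_neg_cancel]
      exact zero_mem _
    · have := xElt_mem_spanCard (k := k) cs (show K.card < m - 1 by omega)
      exact add_mem (Submodule.smul_mem _ _ this) (Submodule.smul_mem _ _ this)
  exact hle hy

/-- If the longest element is central, the radical lowers the filtration by two steps. -/
theorem jacobson_mul_mem_spanCard_sub_two {w₀ : W} (h : cs.IsLongest w₀)
    (hc : ∀ w, w₀ * w = w * w₀) (h2 : (2 : k) ≠ 0) {r : descentAlgebra cs k}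
    (hr : r ∈ Ring.jacobson (descentAlgebra cs k)) {m : ℕ} {y : MonoidAlgebra k W}
    (hy : y ∈ spanCard cs k m) : (r : MonoidAlgebra k W) * y ∈ spanCard cs k (m - 2) := by
  have h1 := jacobson_mul_mem_spanCard_sub_one cs hr hy
  rcases m with _ | m
  · exact h1
  rw [Nat.add_sub_cancel] at h1
  -- Here the original index is `m + 1`. The sign of `w₀` is taken on `y` before applying `r` and on
  -- `r y` afterwards; the two signs differ, so subtraction leaves `± 2 r y` in the lower term.
  have h3 := jacobson_mul_mem_spanCard_sub_one cs hr (mul_of_add_mem_spanCard cs h hc hy)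
  have h4 := mul_of_add_mem_spanCard cs h hc h1
  rw [Nat.add_sub_cancel] at h3
  rw [show m + 1 - 2 = m - 1 by omega]
  have h5 := sub_mem h4 h3
  have h6 : (r : MonoidAlgebra k W) * y * MonoidAlgebra.of k W w₀ +
      (-1 : k) ^ m • ((r : MonoidAlgebra k W) * y) -
      (r : MonoidAlgebra k W) * (y * MonoidAlgebra.of k W w₀ + (-1 : k) ^ (m + 1) • y) =
      ((-1 : k) ^ m * 2) • ((r : MonoidAlgebra k W) * y) := by
    rw [mul_add, mul_smul_comm, ← mul_assoc, pow_succ]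
    module
  rw [h6] at h5
  exact (Submodule.smul_mem_iff _ (mul_ne_zero (pow_ne_zero _ (neg_ne_zero.2 one_ne_zero)) h2)).1 h5

theorem xElt_univ : xElt cs k Set.univ = 1 := by
  have h1 (w : W) : w ∈ minCosetReps cs (Set.univ : Set B) ↔ w = 1 := by
    rw [mem_minCosetReps_iff]
    refine ⟨fun h ↦ cs.eq_one_of_invSign fun i ↦ h i trivial, ?_⟩
    rintro rfl i _
    exact cs.invSign_one _
  have h2 : (Set.toFinite (minCosetReps cs (Set.univ : Set B))).toFinset = {1} := by
    ext w
    simp [h1]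
  rw [xElt, h2, Finset.sum_singleton, map_one]

theorem xElt_empty_mul_self :
    xElt cs k ∅ * xElt cs k ∅ = (Nat.card W : k) • xElt cs k ∅ := by
  have := Fintype.ofFinite W
  have h1 : (Set.toFinite (minCosetReps cs (∅ : Set B))).toFinset = Finset.univ := by
    ext w
    simp [mem_minCosetReps_iff]
  have h2 (w : W) : MonoidAlgebra.of k W w * xElt cs k ∅ = xElt cs k ∅ := by
    rw [xElt, h1, Finset.mul_sum]
    simp only [← map_mul]
    exact Equiv.sum_comp (Equiv.mulLeft w) (MonoidAlgebra.of k W)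
  conv_lhs =>
    lhs
    rw [xElt, h1]
  rw [Finset.sum_mul]
  simp only [h2]
  rw [Finset.sum_const, Finset.card_univ, Nat.card_eq_fintype_card, Nat.cast_smul_eq_nsmul]

/-- If `r = c x_∅` with `c ≠ 0`, then `r² = d r` for `d = c |W| ≠ 0`. So `1 - d⁻¹ r` kills `r`, yet
it has a left inverse because `r` is in the radical. -/
theorem eq_zero_of_mem_jacobson_of_mem_spanCard_one (hk : (Nat.card W : k) ≠ 0)
    {r : descentAlgebra cs k} (hr : r ∈ Ring.jacobson (descentAlgebra cs k))
    (h1 : (r : MonoidAlgebra k W) ∈ spanCard cs k 1) : r = 0 := by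
  have h2 : {K : Finset B | K.card < 1} = {∅} := by
    ext K
    simp
  rw [spanCard, h2, Set.image_singleton, Submodule.mem_span_singleton] at h1
  obtain ⟨c, hc⟩ := h1
  by_cases hc0 : c = 0
  · rw [hc0, zero_smul] at hc
    exact Subtype.ext hc.symm
  have hd : c * (Nat.card W : k) ≠ 0 := mul_ne_zero hc0 hk
  have hsq : r * r = (c * (Nat.card W : k)) • r := by
    apply Subtype.ext
    rw [Subalgebra.coe_mul, Subalgebra.coe_smul, ← hc, Finset.coe_empty, smul_mul_smul_comm,
      xElt_empty_mul_self, smul_smul, smul_smul]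
    congr 1
    ring
  obtain ⟨z, hz⟩ := exists_mul_one_sub_eq_one
    (Submodule.smul_of_tower_mem _ (c * (Nat.card W : k))⁻¹ hr)
  have h3 : (1 - (c * (Nat.card W : k))⁻¹ • r) * r = 0 := by
    rw [sub_mul, one_mul, smul_mul_assoc, hsq, inv_smul_smul₀ hd, sub_self]
  rw [← one_mul r, ← hz, mul_assoc, h3, mul_zero]

theorem coe_mem_spanCard_of_mem_jacobson_pow [Finite B] {w₀ : W} (h : cs.IsLongest w₀)
    (hc : ∀ w, w₀ * w = w * w₀) (h2 : (2 : k) ≠ 0) (l : ℕ) {r : descentAlgebra cs k}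
    (hr : r ∈ Ring.jacobson (descentAlgebra cs k) ^ l) :
    (r : MonoidAlgebra k W) ∈ spanCard cs k (Nat.card B + 1 - 2 * l) := by
  induction l generalizing r with
  | zero =>
    have := Fintype.ofFinite B
    have h1 : (1 : MonoidAlgebra k W) ∈ spanCard cs k (Nat.card B + 1) := by
      rw [← xElt_univ cs, ← Finset.coe_univ]
      exact xElt_mem_spanCard cs (by rw [Finset.card_univ, Nat.card_eq_fintype_card]; omega)
    have hle (m : ℕ) (y : MonoidAlgebra k W) (hy : y ∈ spanCard cs k m) :
        (r : MonoidAlgebra k W) * y ∈ spanCard cs k m := by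
      have hle : spanCard cs k m ≤
          (spanCard cs k m).comap (LinearMap.mulLeft k (r : MonoidAlgebra k W)) := by
        refine Submodule.span_le.2 ?_
        rintro _ ⟨K, hK : K.card < m, rfl⟩
        obtain ⟨c, y, hy, h⟩ := (mem_spanSubsets_iff cs).1
          (mul_xElt_mem_spanSubsets cs r.2 (K : Set B))
        change (r : MonoidAlgebra k W) * xElt cs k (K : Set B) ∈ spanCard cs k m
        rw [h]
        exact add_mem (Submodule.smul_mem _ _ (xElt_mem_spanCard cs hK))
          (spanCard_mono cs hK.le (spanSSubsets_le_spanCard cs K hy))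
      exact hle hy
    simpa using hle _ _ h1
  | succ l ih =>
    -- The new radical factor is split off on the left, the side on which the radical lowers the
    -- filtration.
    rw [Ideal.IsTwoSided.pow_succ, ← Ideal.smul_eq_mul] at hr
    induction hr using Submodule.smul_induction_on' with
    | smul a ha b hb =>
      rw [smul_eq_mul, Subalgebra.coe_mul]
      have := jacobson_mul_mem_spanCard_sub_two cs h hc h2 ha (ih hb)
      rwa [show Nat.card B + 1 - 2 * (l + 1) = Nat.card B + 1 - 2 * l - 2 by omega]
    | add a _ b _ ha hb =>
      exact add_mem ha hb

/-- If the longest element is central, then the Loewy length is at most `(n + 1) / 2`. -/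
theorem jacobson_pow_eq_bot [Finite B] [Nonempty B] {w₀ : W} (h : cs.IsLongest w₀)
    (hc : ∀ w, w₀ * w = w * w₀) (hk : (Nat.card W : k) ≠ 0) :
    Ring.jacobson (descentAlgebra cs k) ^ ((Nat.card B + 1) / 2) = ⊥ := by
  have h2 : (2 : k) ≠ 0 := by
    intro h2
    obtain ⟨i⟩ := ‹Nonempty B›
    have hne : cs.simple i ≠ 1 := by
      intro h1
      have := cs.length_simple i
      rw [h1, cs.length_one] at this
      exact absurd this (by decide)
    have hdvd : 2 ∣ Nat.card W := by
      rw [← orderOf_eq_prime (cs.simple_sq i) hne]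
      exact orderOf_dvd_natCard _
    obtain ⟨d, hd⟩ := hdvd
    apply hk
    rw [hd, Nat.cast_mul, Nat.cast_ofNat, h2, zero_mul]
  have hn : 0 < Nat.card B := Nat.card_pos
  rw [eq_bot_iff]
  intro r hr
  have h1 := coe_mem_spanCard_of_mem_jacobson_pow cs h hc h2 _ hr
  rw [Ideal.mem_bot]
  -- The index `n + 1 - 2 ⌊(n + 1) / 2⌋` is at most 1. Since `n ≥ 1`, the exponent is positive, so
  -- the power lies in the radical.
  refine eq_zero_of_mem_jacobson_of_mem_spanCard_one cs hk ?_ (spanCard_mono cs (by omega) h1)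
  exact Ideal.pow_le_self (by omega) hr

end DescentAlg

end

/-! ### Diagram automorphisms induced by conjugation. -/

noncomputable section

namespace CoxeterSystem

variable {B W : Type*} [Group W] {M : CoxeterMatrix B} (cs : CoxeterSystem M W)

/-- `w` permutes the simple reflections by conjugation, via `σ`. -/
def Permutes (w : W) (σ : B → B) : Prop := ∀ i, w * cs.simple i = cs.simple (σ i) * w

namespace Permutes

variable {cs} {w : W} {σ : B → B} (h : cs.Permutes w σ)
include h

theorem injective : Function.Injective σ := by
  intro i j hij
  apply cs.simple_injective
  apply mul_left_cancel (a := w)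
  rw [h, h, hij]

theorem matrix_apply (h0 : ∀ i j, M i j ≠ 0) (i j : B) : M (σ i) (σ j) = M i j := by
  have h1 : cs.simple (σ i) * cs.simple (σ j) = w * (cs.simple i * cs.simple j) * w⁻¹ := by
    rw [← mul_assoc w, h, mul_assoc _ w, h]
    group
  rw [← cs.orderOf_simple_mul_simple (h0 i j), ← cs.orderOf_simple_mul_simple (h0 _ _), h1,
    ← MulAut.conj_apply]
  exact orderOf_injective (MulAut.conj w).toMonoidHom (MulAut.conj w).injective _

/-- A liftable `f` is a sign character of `W`, hence constant on conjugacy classes. This separates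
nodes that a diagram symmetry may exchange. -/
theorem apply_eq_of_isLiftable {f : B → ℤˣ} (hf : M.IsLiftable f) (i : B) : f (σ i) = f i := by
  have := congrArg (cs.lift ⟨f, hf⟩) (h i)
  rw [map_mul, map_mul, cs.lift_apply_simple hf, cs.lift_apply_simple hf, mul_comm] at this
  exact (mul_right_cancel this).symm

theorem sum_invariant [Fintype B] (h0 : ∀ i j, M i j ≠ 0) {x : B → ℕ}
    (hx : ∀ i, x (σ i) = x i) (i : B) :
    ∑ j, M (σ i) j * x j = ∑ j, M i j * x j := by
  have hb : Function.Bijective σ := Finite.injective_iff_bijective.1 h.injective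
  rw [← hb.sum_comp fun j ↦ M (σ i) j * x j]
  exact Finset.sum_congr rfl fun j _ ↦ by rw [h.matrix_apply h0, hx]

end Permutes

/-- Fixed points propagate down the path: among the nodes up to `p`, only `p` is joined to the fixed
node `p + 1`, and injectivity keeps the image of `p` among these nodes. -/
theorem Permutes.eq_self_of_path {n : ℕ} {N : CoxeterMatrix (Fin n)} {cs : CoxeterSystem N W}
    {w : W} {σ : Fin n → Fin n} (h : cs.Permutes w σ) (h0 : ∀ i j, N i j ≠ 0) {p : ℕ} (hp : p < n)
    (hfix : ∀ i : Fin n, p ≤ i → σ i = i)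
    (hadj : ∀ i j : Fin n, (i : ℕ) + 1 = j → (j : ℕ) ≤ p → N i j ≠ 2)
    (hnon : ∀ i j : Fin n, (i : ℕ) + 1 < j → (j : ℕ) ≤ p → N i j = 2) (i : Fin n) : σ i = i := by
  induction p with
  | zero => exact hfix i (Nat.zero_le _)
  | succ p ih =>
    refine ih (by omega) (fun j hj ↦ ?_) (fun i j h1 h2 ↦ hadj i j h1 (by omega))
      (fun i j h1 h2 ↦ hnon i j h1 (by omega))
    rcases hj.eq_or_lt with hj | hj
    · have h1 : (σ j : ℕ) ≤ p := by
        by_contra hlt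
        have h2 := h.injective (hfix (σ j) (by omega))
        rw [h2] at hlt
        omega
      have h2 := h.matrix_apply h0 j ⟨p + 1, hp⟩
      rw [hfix ⟨p + 1, hp⟩ le_rfl] at h2
      have h3 := hadj j ⟨p + 1, hp⟩ (by simp [← hj]) le_rfl
      by_contra hne
      have h4 : (σ j : ℕ) ≠ j := fun h' ↦ hne (Fin.ext h')
      exact h3 (h2 ▸ hnon (σ j) ⟨p + 1, hp⟩ (show (σ j : ℕ) + 1 < p + 1 by omega) le_rfl)
    · exact hfix j hj

end CoxeterSystem

namespace DescentAlg

open CoxeterSystem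

variable {W : Type*} [Group W]

/-! ### The types `E₇`, `E₈`, `F₄`, `H₃`, `H₄` -/

/-- The entries of a Coxeter matrix, as a function. -/
def entry {n : ℕ} (N : CoxeterMatrix (Fin n)) (i j : Fin n) : ℕ := N i j

/-- Iterated application of a matrix to a vector of natural numbers. -/
def iterMul {n : ℕ} (N : Fin n → Fin n → ℕ) (x : Fin n → ℕ) : ℕ → Fin n → ℕ
  | 0 => x
  | l + 1 => fun i ↦ ∑ j, N i j * iterMul N x l j

/-- Multiplying a `σ`-invariant vector by the Coxeter matrix gives another invariant vector; once
its entries are distinct, `σ` is the identity. -/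
theorem eq_self_of_iterMul {n : ℕ} {N : CoxeterMatrix (Fin n)} {cs : CoxeterSystem N W}
    {w : W} {σ : Fin n → Fin n} (h : cs.Permutes w σ) (h0 : ∀ i j, entry N i j ≠ 0) {x : Fin n → ℕ}
    (hx : ∀ i, x (σ i) = x i) (l : ℕ)
    (hinj : ∀ i j, iterMul (entry N) x l i = iterMul (entry N) x l j → i = j)
    (i : Fin n) : σ i = i := by
  have key (l : ℕ) : ∀ i, iterMul (entry N) x l (σ i) =
      iterMul (entry N) x l i := by
    induction l with
    | zero => exact hx
    | succ l ih => exact h.sum_invariant h0 ih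
  exact hinj _ _ (key l i)

theorem eq_self_E₇ {cs : CoxeterSystem CoxeterMatrix.E₇ W} {w : W} {σ : Fin 7 → Fin 7}
    (h : cs.Permutes w σ) : ∀ i, σ i = i :=
  eq_self_of_iterMul h (by decide) (x := fun _ ↦ 1) (fun _ ↦ rfl) 3 (by decide)

theorem eq_self_E₈ {cs : CoxeterSystem CoxeterMatrix.E₈ W} {w : W} {σ : Fin 8 → Fin 8}
    (h : cs.Permutes w σ) : ∀ i, σ i = i :=
  eq_self_of_iterMul h (by decide) (x := fun _ ↦ 1) (fun _ ↦ rfl) 3 (by decide)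

theorem eq_self_H₃ {cs : CoxeterSystem CoxeterMatrix.H₃ W} {w : W} {σ : Fin 3 → Fin 3}
    (h : cs.Permutes w σ) : ∀ i, σ i = i :=
  eq_self_of_iterMul h (by decide) (x := fun _ ↦ 1) (fun _ ↦ rfl) 1 (by decide)

theorem eq_self_H₄ {cs : CoxeterSystem CoxeterMatrix.H₄ W} {w : W} {σ : Fin 4 → Fin 4}
    (h : cs.Permutes w σ) : ∀ i, σ i = i :=
  eq_self_of_iterMul h (by decide) (x := fun _ ↦ 1) (fun _ ↦ rfl) 2 (by decide)

/-- The diagram with its labels has a flip, so the constant vector cannot work. The starting vector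
is instead the indicator of one of the two conjugacy classes of simple reflections, invariant by a
sign character. -/
theorem eq_self_F₄ {cs : CoxeterSystem CoxeterMatrix.F₄ W} {w : W} {σ : Fin 4 → Fin 4}
    (h : cs.Permutes w σ) : ∀ i, σ i = i := by
  have hf : CoxeterMatrix.F₄.IsLiftable fun i : Fin 4 ↦ if 2 ≤ i then (-1 : ℤˣ) else 1 := by
    have : ∀ i j : Fin 4, ((if 2 ≤ i then (-1 : ℤˣ) else 1) * (if 2 ≤ j then (-1 : ℤˣ) else 1)) ^
      entry CoxeterMatrix.F₄ i j = 1 := by decide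
    exact this
  have h1 (i : Fin 4) := h.apply_eq_of_isLiftable hf i
  refine eq_self_of_iterMul h (by decide) (x := fun i ↦ if 2 ≤ i then 1 else 0) (fun i ↦ ?_) 2
    (by decide)
  have := h1 i
  split_ifs at this ⊢ <;> first | rfl | exact absurd this (by decide)

/-! ### The types `I₂(2m)` and `Bₘ` -/

theorem eq_self_I {r : ℕ} (hr : Even r) {cs : CoxeterSystem (CoxeterMatrix.I r) W} {w : W}
    {σ : Fin 2 → Fin 2} (h : cs.Permutes w σ) : ∀ i, σ i = i := by
  have hf : (CoxeterMatrix.I r).IsLiftable fun i : Fin 2 ↦ if i = 1 then (-1 : ℤˣ) else 1 := by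
    intro i j
    by_cases hij : i = j
    · subst hij
      rw [CoxeterMatrix.diagonal, pow_one, Int.units_mul_self]
    · have : (CoxeterMatrix.I r) i j = r + 2 := by simp [CoxeterMatrix.I, hij]
      change _ ^ (CoxeterMatrix.I r) i j = 1
      rw [this]
      obtain ⟨c, rfl⟩ := hr
      rw [← two_mul, show 2 * c + 2 = 2 * (c + 1) by ring, pow_mul, Int.units_sq, one_pow]
  intro i
  have := h.apply_eq_of_isLiftable hf i
  revert this
  generalize σ i = j
  revert i j
  decide

theorem matrixB_apply {n : ℕ} (i j : Fin n) : CoxeterMatrix.B n i j =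
    if i = j then 1
      else (if (i : ℕ) = n - 1 ∧ (j : ℕ) = n - 2 ∨ (j : ℕ) = n - 1 ∧ (i : ℕ) = n - 2 then 4
        else (if (j : ℕ) + 1 = i ∨ (i : ℕ) + 1 = j then 3 else 2)) := rfl

theorem eq_self_B {n : ℕ} {cs : CoxeterSystem (CoxeterMatrix.B n) W} {w : W}
    {σ : Fin n → Fin n} (h : cs.Permutes w σ) (i : Fin n) : σ i = i := by
  have h0 (i j : Fin n) : CoxeterMatrix.B n i j ≠ 0 := by
    rw [matrixB_apply]
    split_ifs <;> decide
  have hf : (CoxeterMatrix.B n).IsLiftable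
      fun i : Fin n ↦ if (i : ℕ) = n - 1 then (-1 : ℤˣ) else 1 := by
    intro i j
    rw [matrixB_apply]
    have hij : i = j ↔ (i : ℕ) = j := Fin.ext_iff
    beta_reduce
    split_ifs <;> first | omega | decide
  have hn := i.2
  refine h.eq_self_of_path h0 (show n - 1 < n by omega) (fun j hj ↦ ?_) (fun i j h1 h2 ↦ ?_)
    (fun i j h1 h2 ↦ ?_) i
  · have := h.apply_eq_of_isLiftable hf j
    have hj' : (j : ℕ) = n - 1 := by omega
    rw [if_pos hj'] at this
    have h2 : (σ j : ℕ) = n - 1 := by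
      by_contra hne
      rw [if_neg hne] at this
      exact absurd this (by decide)
    exact Fin.ext (h2.trans hj'.symm)
  · rw [matrixB_apply]
    have hij : i = j ↔ (i : ℕ) = j := Fin.ext_iff
    split_ifs <;> omega
  · rw [matrixB_apply]
    have hij : i = j ↔ (i : ℕ) = j := Fin.ext_iff
    split_ifs <;> omega

end DescentAlg

end

noncomputable section

namespace DescentAlg

open CoxeterSystem

/-! ### The type `D₂ₘ` -/

/-- Exchange of the coordinates `a` and `b` of a sequence in `ZMod 2`, followed by addition of `c`
to both of them. -/
def swapAdd (a b : ℕ) (c : ZMod 2) : Equiv.Perm (ℕ → ZMod 2) :=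
  Function.Involutive.toPerm
    (fun v x ↦ if x = a then v b + c else if x = b then v a + c else v x) <| by
    intro v
    funext x
    have hc : c + c = 0 := CharTwo.add_self_eq_zero c
    dsimp only
    split_ifs <;> simp_all [add_assoc]

theorem swapAdd_apply (a b : ℕ) (c : ZMod 2) (v : ℕ → ZMod 2) (x : ℕ) :
    swapAdd a b c v x = if x = a then v b + c else if x = b then v a + c else v x := rfl

theorem swapAdd_mul_self (a b : ℕ) (c : ZMod 2) : swapAdd a b c * swapAdd a b c = 1 := by
  ext1 v
  exact (swapAdd a b c).left_inv v

theorem swapAdd_commute_of_disjoint {a b a' b' : ℕ} (h1 : a ≠ a') (h2 : a ≠ b') (h3 : b ≠ a')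
    (h4 : b ≠ b') (c c' : ZMod 2) : Commute (swapAdd a b c) (swapAdd a' b' c') := by
  ext1 v
  funext x
  simp only [Equiv.Perm.mul_apply, swapAdd_apply]
  split_ifs <;> simp_all

theorem swapAdd_commute (a b : ℕ) (c c' : ZMod 2) :
    Commute (swapAdd a b c) (swapAdd a b c') := by
  ext1 v
  funext x
  simp only [Equiv.Perm.mul_apply, swapAdd_apply]
  split_ifs <;> simp_all [add_right_comm]

theorem swapAdd_braid {a b d : ℕ} (h1 : a ≠ b) (h2 : b ≠ d) (h3 : a ≠ d) (c c' : ZMod 2) :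
    swapAdd a b c * swapAdd b d c' * swapAdd a b c =
      swapAdd b d c' * swapAdd a b c * swapAdd b d c' := by
  have hc : ∀ e : ZMod 2, e + e = 0 := CharTwo.add_self_eq_zero
  ext1 v
  funext x
  simp only [Equiv.Perm.mul_apply, swapAdd_apply]
  split_ifs <;> simp_all [add_right_comm, add_assoc]

theorem mul_pow_two_eq_one {G : Type*} [Group G] {a b : G} (ha : a * a = 1) (hb : b * b = 1)
    (h : Commute a b) : (a * b) ^ 2 = 1 := by
  rw [h.mul_pow, pow_two, pow_two, ha, hb, one_mul]

theorem mul_pow_three_eq_one {G : Type*} [Group G] {a b : G} (ha : a * a = 1) (hb : b * b = 1)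
    (h : a * b * a = b * a * b) : (a * b) ^ 3 = 1 := by
  calc (a * b) ^ 3 = a * b * a * (b * a * b) := by simp only [pow_succ, pow_zero, one_mul, mul_assoc]
    _ = a * b * (a * a) * b * a := by rw [← h]; simp only [mul_assoc]
    _ = 1 := by rw [ha, mul_one, mul_assoc a, hb, mul_one, ha]

theorem matrixD_apply {n : ℕ} (i j : Fin n) : matrixD n i j =
    if i = j then 1
    else if ((i : ℕ) + 1 = j ∧ (j : ℕ) + 1 < n) ∨ ((j : ℕ) + 1 = i ∧ (i : ℕ) + 1 < n) ∨
        ((i : ℕ) + 2 = j ∧ (j : ℕ) + 1 = n) ∨ ((j : ℕ) + 2 = i ∧ (i : ℕ) + 1 = n) then 3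
    else 2 := rfl

/-- The simple reflections of type `Dₙ` as signed permutations, acting on sequences of signs. -/
def signPerm (n : ℕ) (i : Fin n) : Equiv.Perm (ℕ → ZMod 2) :=
  if (i : ℕ) + 1 < n then swapAdd i (i + 1) 0 else swapAdd (n - 2) (n - 1) 1

theorem signPerm_mul_self {n : ℕ} (i : Fin n) : signPerm n i * signPerm n i = 1 := by
  rw [signPerm]
  split_ifs <;> exact swapAdd_mul_self _ _ _

theorem isLiftable_signPerm {n : ℕ} (hn : 2 ≤ n) : (matrixD n).IsLiftable (signPerm n) := by
  suffices ∀ i j : Fin n, i < j → (signPerm n i * signPerm n j) ^ matrixD n i j = 1 by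
    intro i j
    rcases lt_trichotomy i j with h | rfl | h
    · exact this i j h
    · rw [CoxeterMatrix.diagonal, pow_one, signPerm_mul_self]
    · have h1 := congrArg (·⁻¹) (this j i h)
      have hinv (i : Fin n) : (signPerm n i)⁻¹ = signPerm n i :=
        inv_eq_of_mul_eq_one_left (signPerm_mul_self i)
      simp only [← inv_pow, mul_inv_rev, hinv, inv_one] at h1
      rw [(matrixD n).symmetric j i] at h1
      exact h1
  intro i j hij
  have hij' : (i : ℕ) < j := hij
  have hne : i ≠ j := hij.ne
  have hj := j.2
  have hi1 : (i : ℕ) + 1 < n := by omega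
  have hi : signPerm n i = swapAdd i (i + 1) 0 := by rw [signPerm, if_pos hi1]
  rw [matrixD_apply, if_neg hne]
  by_cases hj1 : (j : ℕ) + 1 < n
  · have hj' : signPerm n j = swapAdd j (j + 1) 0 := by rw [signPerm, if_pos hj1]
    by_cases h : (i : ℕ) + 1 = j
    · rw [if_pos (Or.inl ⟨h, hj1⟩)]
      refine mul_pow_three_eq_one (signPerm_mul_self i) (signPerm_mul_self j) ?_
      rw [hi, hj', h]
      exact swapAdd_braid (by omega) (by omega) (by omega) _ _
    · rw [if_neg (by omega)]
      refine mul_pow_two_eq_one (signPerm_mul_self i) (signPerm_mul_self j) ?_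
      rw [hi, hj']
      exact swapAdd_commute_of_disjoint (by omega) (by omega) (by omega) (by omega) _ _
  · have hj' : signPerm n j = swapAdd (n - 2) (n - 1) 1 := by rw [signPerm, if_neg hj1]
    by_cases h : (i : ℕ) + 2 = j
    · rw [if_pos (by omega)]
      refine mul_pow_three_eq_one (signPerm_mul_self i) (signPerm_mul_self j) ?_
      rw [hi, hj', show (i : ℕ) + 1 = n - 2 by omega]
      exact swapAdd_braid (by omega) (by omega) (by omega) _ _
    · rw [if_neg (by omega)]
      refine mul_pow_two_eq_one (signPerm_mul_self i) (signPerm_mul_self j) ?_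
      rw [hi, hj']
      by_cases h' : (i : ℕ) + 1 = j
      · rw [show (i : ℕ) = n - 2 by omega, show n - 2 + 1 = n - 1 by omega]
        exact swapAdd_commute _ _ _ _
      · exact swapAdd_commute_of_disjoint (by omega) (by omega) (by omega) (by omega) _ _

/-- The shift `c` is added to two coordinates, and `c + c = 0`: the parity of the number of minus
signs is preserved. -/
theorem sum_swapAdd {n a b : ℕ} (ha : a < n) (hb : b < n) (hab : a ≠ b) (c : ZMod 2)
    (v : ℕ → ZMod 2) :
    ∑ x ∈ Finset.range n, swapAdd a b c v x = ∑ x ∈ Finset.range n, v x := by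
  have h1 (f : ℕ → ZMod 2) : ∑ x ∈ Finset.range n, f x =
      f a + (f b + ∑ x ∈ ((Finset.range n).erase a).erase b, f x) := by
    rw [Finset.add_sum_erase _ _ (by simp [hb, hab.symm]),
      Finset.add_sum_erase _ _ (by simp [ha])]
  rw [h1, h1 v, Finset.sum_congr rfl fun x hx ↦ ?_]
  · rw [swapAdd_apply, swapAdd_apply, if_pos rfl, if_neg hab.symm, if_pos rfl]
    have hc : c + c = 0 := CharTwo.add_self_eq_zero c
    linear_combination hc
  · simp only [Finset.mem_erase] at hx
    rw [swapAdd_apply, if_neg hx.2.1, if_neg hx.1]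

variable {W : Type*} [Group W]

/-- The action of the Coxeter group of type `Dₙ` on sequences of signs. -/
def signHom {n : ℕ} (hn : 2 ≤ n) (cs : CoxeterSystem (matrixD n) W) :
    W →* Equiv.Perm (ℕ → ZMod 2) :=
  cs.lift ⟨signPerm n, isLiftable_signPerm hn⟩

theorem sum_signHom {n : ℕ} (hn : 2 ≤ n) (cs : CoxeterSystem (matrixD n) W) (w : W)
    (v : ℕ → ZMod 2) :
    ∑ x ∈ Finset.range n, signHom hn cs w v x = ∑ x ∈ Finset.range n, v x := by
  induction w using cs.simple_induction_left with
  | one => simp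
  | mul_simple_left w i ih =>
    rw [map_mul, Equiv.Perm.mul_apply, ← ih, signHom, cs.lift_apply_simple, signPerm]
    split_ifs with h
    · exact sum_swapAdd (by omega) h (by omega) _ _
    · exact sum_swapAdd (by omega) (by omega) (by omega) _ _

/-- A vector fixed by all simple reflections but one identifies the omitted node. If that node were
below `n - 2`, the last two reflections would force contradictory relations between the last two
coordinates. Otherwise the vector is constant up to a shift of the last coordinate, and the parity
tells the two end nodes apart. -/
theorem sum_of_fixed {n : ℕ} (hn : 2 ≤ n) (heven : Even n) {c : Fin n} {v : ℕ → ZMod 2}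
    (hv : ∀ i : Fin n, i ≠ c → signPerm n i v = v) :
    ((c : ℕ) = n - 1 ∧ ∑ x ∈ Finset.range n, v x = 0) ∨
      ((c : ℕ) = n - 2 ∧ ∑ x ∈ Finset.range n, v x = 1) := by
  have h1 (i : ℕ) (hi : i + 1 < n) (hic : i ≠ c) : v i = v (i + 1) := by
    have := congrFun (hv ⟨i, by omega⟩ fun h ↦ hic (congrArg Fin.val h)) i
    rw [signPerm, if_pos hi, swapAdd_apply, if_pos rfl, add_zero] at this
    exact this.symm
  have h2 (hc : (c : ℕ) ≠ n - 1) : v (n - 1) = v (n - 2) + 1 := by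
    have := congrFun (hv ⟨n - 1, by omega⟩ fun h ↦ hc (congrArg Fin.val h).symm) (n - 1)
    rw [signPerm, if_neg (by simp; omega), swapAdd_apply, if_neg (by omega), if_pos rfl] at this
    exact this.symm
  have hlast : ∀ x, x + 1 < n → (∀ i, i + 2 < n → i ≠ c) → v x = v (n - 2) := by
    intro x hx hne
    obtain ⟨y, hy⟩ : ∃ y, n - 2 = x + y := ⟨n - 2 - x, by omega⟩
    induction y generalizing x with
    | zero => rw [hy, add_zero]
    | succ y ih =>
      rw [h1 x hx (hne x (by omega)), ih (x + 1) (by omega) (by omega)]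
  have hsum (d : ZMod 2) (h : v (n - 1) = v (n - 2) + d) (hne : ∀ i, i + 2 < n → i ≠ c) :
      ∑ x ∈ Finset.range n, v x = d := by
    have h3 : ∀ x ∈ Finset.range n, v x = v (n - 2) + if x = n - 1 then d else 0 := by
      intro x hx
      rw [Finset.mem_range] at hx
      split_ifs with h'
      · rw [h', h]
      · rw [add_zero, hlast x (by omega) hne]
    rw [Finset.sum_congr rfl h3, Finset.sum_add_distrib, Finset.sum_const, Finset.card_range,
      Finset.sum_ite_eq', if_pos (Finset.mem_range.2 (by omega))]
    -- Evenness of `n` enters here: the `n` copies of the constant coordinate sum to zero.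
    obtain ⟨m, rfl⟩ := heven
    rw [add_smul, CharTwo.add_self_eq_zero, zero_add]
  have hc := c.2
  by_cases hc1 : (c : ℕ) = n - 1
  · refine Or.inl ⟨hc1, hsum 0 ?_ (by omega)⟩
    have := h1 (n - 2) (by omega) (by omega)
    rw [add_zero, this]
    congr 1
    omega
  · by_cases hc2 : (c : ℕ) = n - 2
    · exact Or.inr ⟨hc2, hsum 1 (h2 hc1) (by omega)⟩
    · exfalso
      have h3 := h1 (n - 2) (by omega) (by omega)
      rw [show n - 2 + 1 = n - 1 by omega, h2 hc1] at h3
      simp at h3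

/-- If `v` is fixed by every simple reflection except that of node `c`, then `w v` is fixed by every
one except that of `σ c`, and `v` and `w v` have equal parity. The zero vector then shows that `σ`
fixes `n - 1`, and the last unit vector that it fixes `n - 2`; the rest of the diagram is a path
ending at `n - 2`. -/
theorem eq_self_D {n : ℕ} (hn : 2 ≤ n) (heven : Even n) {cs : CoxeterSystem (matrixD n) W} {w : W}
    {σ : Fin n → Fin n} (h : cs.Permutes w σ) (i : Fin n) : σ i = i := by
  have hb : Function.Bijective σ := Finite.injective_iff_bijective.1 h.injective
  have key (c : Fin n) (v : ℕ → ZMod 2) (hv : ∀ i : Fin n, i ≠ c → signPerm n i v = v) (j : Fin n)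
      (hj : j ≠ σ c) : signPerm n j (signHom hn cs w v) = signHom hn cs w v := by
    obtain ⟨i, rfl⟩ := hb.2 j
    have h1 := congrArg (signHom hn cs) (h i)
    rw [map_mul, map_mul, signHom, cs.lift_apply_simple, cs.lift_apply_simple] at h1
    have h2 := congrArg (fun e ↦ e v) h1
    simp only [Equiv.Perm.mul_apply] at h2
    rw [hv i (by rintro rfl; exact hj rfl)] at h2
    exact h2.symm
  have hv0 (i : Fin n) (hi : i ≠ ⟨n - 1, by omega⟩) : signPerm n i 0 = 0 := by
    have hi' : (i : ℕ) ≠ n - 1 := fun h ↦ hi (Fin.ext h)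
    rw [signPerm, if_pos (by omega)]
    funext x
    simp [swapAdd_apply]
  have hv1 (i : Fin n) (hi : i ≠ ⟨n - 2, by omega⟩) :
      signPerm n i (Pi.single (n - 1) 1) = Pi.single (n - 1) 1 := by
    have hi' : (i : ℕ) ≠ n - 2 := fun h ↦ hi (Fin.ext h)
    rw [signPerm]
    funext x
    split_ifs with hlt <;> simp only [swapAdd_apply, Pi.single_apply] <;> split_ifs <;>
      first | omega | rfl
  have hlast : σ ⟨n - 1, by omega⟩ = ⟨n - 1, by omega⟩ := by
    rcases sum_of_fixed hn heven (key _ _ hv0) with ⟨h1, -⟩ | ⟨-, h2⟩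
    · exact Fin.ext h1
    · rw [sum_signHom] at h2
      simp at h2
  have hlast' : σ ⟨n - 2, by omega⟩ = ⟨n - 2, by omega⟩ := by
    rcases sum_of_fixed hn heven (key _ _ hv1) with ⟨-, h2⟩ | ⟨h1, -⟩
    · simp only [sum_signHom, Pi.single_apply] at h2
      rw [Finset.sum_ite_eq', if_pos (Finset.mem_range.2 (by omega))] at h2
      exact absurd h2 one_ne_zero
    · exact Fin.ext h1
  have h0 (i j : Fin n) : matrixD n i j ≠ 0 := by
    rw [matrixD_apply]
    split_ifs <;> decide
  refine h.eq_self_of_path h0 (show n - 2 < n by omega) (fun j hj ↦ ?_) (fun i j h1 h2 ↦ ?_)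
    (fun i j h1 h2 ↦ ?_) i
  · obtain hj | hj : (j : ℕ) = n - 2 ∨ (j : ℕ) = n - 1 := by omega
    · rwa [show j = ⟨n - 2, by omega⟩ from Fin.ext hj]
    · rwa [show j = ⟨n - 1, by omega⟩ from Fin.ext hj]
  · rw [matrixD_apply]
    have hij : i = j ↔ (i : ℕ) = j := Fin.ext_iff
    split_ifs <;> omega
  · rw [matrixD_apply]
    have hij : i = j ↔ (i : ℕ) = j := Fin.ext_iff
    split_ifs <;> omega

/-! ### The main theorem -/

theorem eq_self_of_isListedType {B : Type*} {M : CoxeterMatrix B} (cs : CoxeterSystem M W)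
    (hM : IsListedType M) {w : W} {σ : B → B} (h : cs.Permutes w σ) (i : B) : σ i = i := by
  have key {n : ℕ} {N : CoxeterMatrix (Fin n)} (hN : SameType M N)
      (hfix : ∀ (cs : CoxeterSystem N W) (τ : Fin n → Fin n), cs.Permutes w τ → ∀ i, τ i = i) :
      σ i = i := by
    obtain ⟨e, rfl⟩ := hN
    have := hfix (cs.reindex e) (fun i ↦ e (σ (e.symm i))) (fun i ↦ by
      rw [cs.reindex_simple, cs.reindex_simple, h, e.symm_apply_apply]) (e i)
    simpa using this
  rcases hM with hM | ⟨m, -, hM⟩ | ⟨m, hm, hM⟩ | hM | hM | hM | ⟨m, r, -, hr, hM⟩ | hM | hM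
  · exact key hM fun _ _ _ _ ↦ Subsingleton.elim _ _
  · exact key hM fun _ _ h ↦ eq_self_B h
  · exact key hM fun _ _ h ↦ eq_self_D (by omega) (even_two_mul m) h
  · exact key hM fun _ _ h ↦ eq_self_E₇ h
  · exact key hM fun _ _ h ↦ eq_self_E₈ h
  · exact key hM fun _ _ h ↦ eq_self_F₄ h
  · exact key hM fun _ _ h ↦ eq_self_I ⟨m - 1, by omega⟩ h
  · exact key hM fun _ _ h ↦ eq_self_H₃ h
  · exact key hM fun _ _ h ↦ eq_self_H₄ h

theorem nonempty_of_isListedType {B : Type*} {M : CoxeterMatrix B} (hM : IsListedType M) :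
    Nonempty B := by
  have key {n : ℕ} {N : CoxeterMatrix (Fin n)} (hn : 0 < n) (hN : SameType M N) : Nonempty B :=
    ⟨hN.choose.symm ⟨0, hn⟩⟩
  rcases hM with hM | ⟨m, hm, hM⟩ | ⟨m, hm, hM⟩ | hM | hM | hM | ⟨m, r, -, -, hM⟩ | hM | hM
  all_goals exact key (by omega) hM

end DescentAlg

end

theorem mainTheorem10 {B W : Type*} [Group W] [Finite W] {M : CoxeterMatrix B}
    (cs : CoxeterSystem M W) (hM : DescentAlg.IsListedType M)
    (k : Type*) [Field k] (hk : ¬ ringChar k ∣ Nat.card W) :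
    ∃ l : ℕ, DescentAlg.IsLoewyLength (DescentAlg.descentAlgebra cs k) l ∧
      (l : ℚ) ≤ (((Set.range cs.simple).ncard : ℚ) + 1) / 2 := by
  have hB : Finite B := Finite.of_injective _ cs.simple_injective
  have hB' := DescentAlg.nonempty_of_isListedType hM
  obtain ⟨w₀, h⟩ := cs.exists_isLongest
  choose σ hσ using h.exists_conj_simple
  have hperm : cs.Permutes w₀ σ := fun i ↦ by rw [← hσ, mul_assoc, h.mul_self, mul_one]
  have hc : ∀ w, w₀ * w = w * w₀ := fun w ↦ by
    induction w using cs.simple_induction_left with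
    | one => rw [mul_one, one_mul]
    | mul_simple_left w i ih =>
      rw [← mul_assoc, hperm i, DescentAlg.eq_self_of_isListedType cs hM hperm, mul_assoc, ih,
        mul_assoc]
  have hk' : (Nat.card W : k) ≠ 0 := fun h ↦ hk ((ringChar.spec k _).1 h)
  have hbot := DescentAlg.jacobson_pow_eq_bot (k := k) cs h hc hk'
  classical
  have hex : ∃ r : ℕ, Ring.jacobson (DescentAlg.descentAlgebra cs k) ^ r = ⊥ := ⟨_, hbot⟩
  refine ⟨Nat.find hex, ⟨Nat.find_spec hex, fun r hr ↦ Nat.find_min' hex hr⟩, ?_⟩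
  have h1 : (Set.range cs.simple).ncard = Nat.card B := by
    rw [← Set.image_univ, Set.ncard_image_of_injective _ cs.simple_injective, Set.ncard_univ]
  have h2 := Nat.find_min' hex hbot
  rw [h1, le_div_iff₀ two_pos]
  have h3 : Nat.find hex * 2 ≤ Nat.card B + 1 := by omega
  exact_mod_cast h3
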